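/- **Setting.** Let $p>2$ and let $h:[0,\infty)\to\mathbb R$ be a nonnegative $C^1$ function with $h(t)>0$ for all large $t$. Put $f(t)=h(t)e^{t^p}$ and assume that there are $c_0,\tau_0>0$ and $m\in\mathbb R$ such that $f(t)=c_0t^me^{t^p}$ for all $t\ge\tau_0$. Let $(\lambda_n,\mu_n,u_n)$, $n\in\mathbb N$, with $\lambda_n>0$, be solutions of $$-u_n''-\tfrac1r u_n'=\lambda_n f(u_n),\quad u_n>0\ \text{ in }(0,1),\qquad u_n(0)=\mu_n,\quad u_n'(0)=0=u_n(1),$$ with $\mu_n\to\infty$ and $\lambda_n\to\lambda_*\in[0,\infty)$ as $n\to\infty$. Define $a_0=2$, $\delta_0=1$ and, recursively for $k\ge1$, the numbers $\delta_k\in(0,\delta_{k-1})$ and $a_k\in(0,2)$ by $$\frac{2p}{2+a_{k-1}}\Bigl(1-\frac{\delta_k}{\delta_{k-1}}\Bigr)-1+\Bigl(\frac{\delta_k}{\delta_{k-1}}\Bigr)^p=0,\qquad a_k=2-\Bigl(\frac{\delta_k}{\delta_{k-1}}\Bigr)^{p-1}(2+a_{k-1}).$$ For $k\ge0$, a sequence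 $(r_{k,n})_n\subset(0,1)$ is called a sequence of centers of the $(k+1)$-th bubble if, as $n\to\infty$, $$\frac{u_n(r_{k,n})}{\mu_n}\to\delta_k,\qquad p\lambda_n r_{k,n}^2\,u_n(r_{k,n})^{p-1}f(u_n(r_{k,n}))\to\frac{a_k^2}{2}.$$ For $\beta>0$ and $L\in\mathbb R$ let, for small $r>0$, $$U_\beta(r)=\Bigl(\beta\log\tfrac1r\Bigr)^{1/p},\qquad V_L(r)=\Bigl\{2\log\tfrac1r-\Bigl(1-\tfrac{1-m}{p}\Bigr)\log\bigl(2\log\tfrac1r\bigr)+L\Bigr\}^{1/p}.$$ Let $U$ be a continuous function on some interval $(0,R_0)$, $R_0>0$, and assume one of the following. (i) $\lambda_*\neq0$, and for every $\varepsilon\in(0,2)$ and every $L\in\mathbb R$ there is $r_0\in(0,1)$, $r_0\le R_0$, such that $U_{2-\varepsilon}(r)\le U(r)\le V_L(r)$ for all $r\in(0,r_0)$. (ii) $\lambda_*=0$, and for every $\varepsilon\in(0,2)$ there are $r_0\in(0,1)$, $r_0\le R_0$, and $L\in\mathbb R$ such that $U_{2-\varepsilon}(r)\le U(r)\le V_L(r)$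 for all $r\in(0,r_0)$. For an interval $I$, let $Z_I[u_n-U]\in\mathbb N\cup\{\infty\}$ be the number of zeros of $u_n-U$ in $I\cap(0,R_0)$. **Corollary 4.5.** After passing to a subsequence in $n$, the following holds. (a) For every $k\in\mathbb N\cup\{0\}$ there exists a sequence of centers of the $(k+1)$-th bubble. (b) For every $k\in\mathbb N\cup\{0\}$ and every sequence $(r_{k,n})$ of centers of the $(k+1)$-th bubble there exist sequences $(r_{k,n}^{\pm})\subset(0,1)$ such that $r_{k,n}^-<r_{k,n}<r_{k,n}^+$ for all $n$, $u_n(r_{k,n}^{\pm})/\mu_n\to\delta_k$ as $n\to\infty$, and, for all large $n$, $r_{k,n}^\pm<R_0$, $u_n(r_{k,n}^{\pm})=U(r_{k,n}^{\pm})$ and $$Z_{(0,r_{k,n}^+]}[u_n-U]\ge 2(k+1).$$ (c) For every sequence $(r_n)\subset(0,1)$ with $u_n(r_n)/\mu_n\to0$, $$\lim_{n\to\infty}Z_{(0,r_n)}[u_n-U]=\infty.$$ -/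

import Mathlib

open Set Filter Topology

namespace SupercriticalBubbles

/-- The nonlinearity `f(t) = h(t) e^{t^p}`. -/
noncomputable def nonlin (h : ℝ → ℝ) (p t : ℝ) : ℝ := h t * Real.exp (t ^ p)

/-- `h : [0,∞) → ℝ` is a nonnegative `C¹` function which is positive for all large arguments. -/
structure AdmissibleFactor (h : ℝ → ℝ) : Prop where
  contDiffOn : ContDiffOn ℝ 1 h (Ici 0)
  nonneg : ∀ t, 0 ≤ t → 0 ≤ h t
  pos : ∃ t₀ : ℝ, 0 < t₀ ∧ ∀ t, t₀ ≤ t → 0 < h t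

/-- `f(t) = c₀ t^m e^{t^p}` for all `t ≥ τ₀`, with `c₀, τ₀ > 0`. -/
structure PowerExpTail (h : ℝ → ℝ) (p c₀ τ₀ m : ℝ) : Prop where
  c₀_pos : 0 < c₀
  τ₀_pos : 0 < τ₀
  tail : ∀ t, τ₀ ≤ t → nonlin h p t = c₀ * t ^ m * Real.exp (t ^ p)

/-- `(lam, μ, u)` is a (classical) solution of
`-u'' - u'/r = lam f(u)`, `u > 0` in `(0,1)`, `u(0) = μ`, `u'(0) = 0 = u(1)`.
Only the values of `u` on `[0,1]` matter. -/
structure IsRadialSolution (f : ℝ → ℝ) (lam μ : ℝ) (u : ℝ → ℝ) : Prop where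
  lam_pos : 0 < lam
  continuousOn : ContinuousOn u (Icc 0 1)
  contDiffOn : ContDiffOn ℝ 2 u (Ioo 0 1)
  ode : ∀ r ∈ Ioo (0 : ℝ) 1, -(deriv (deriv u) r) - (1 / r) * deriv u r = lam * f (u r)
  pos : ∀ r ∈ Ioo (0 : ℝ) 1, 0 < u r
  at_zero : u 0 = μ
  deriv_zero : HasDerivWithinAt u 0 (Ici 0) 0
  at_one : u 1 = 0

/-- The function whose unique zero in `(0,1)` is the ratio `δ_{k+1} / δ_k`, where `a = a_k`. -/
noncomputable def ratioFun (p a x : ℝ) : ℝ := 2 * p / (2 + a) * (1 - x) - 1 + x ^ p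

/-- The zero of `ratioFun p a` in `(0,1)`; it exists and is unique for `p > 2`, `0 < a ≤ 2`
(see `existsUnique_ratio`). -/
noncomputable def ratio (p a : ℝ) : ℝ := sInf {x : ℝ | x ∈ Ioo (0 : ℝ) 1 ∧ ratioFun p a x = 0}

/-- The numbers `a_k`: `a_0 = 2` and `a_{k+1} = 2 - (δ_{k+1}/δ_k)^{p-1} (2 + a_k)`. -/
noncomputable def aSeq (p : ℝ) : ℕ → ℝ
  | 0 => 2
  | k + 1 => 2 - ratio p (aSeq p k) ^ (p - 1) * (2 + aSeq p k)

/-- The numbers `δ_k`: `δ_0 = 1` and `δ_{k+1}` is `δ_k` times the zero of `ratioFun p a_k`. -/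
noncomputable def δSeq (p : ℝ) : ℕ → ℝ
  | 0 => 1
  | k + 1 => ratio p (aSeq p k) * δSeq p k

theorem exists_ratio_lt {p a : ℝ} (hp : 2 < p) (ha : 0 < a) (ha2 : a ≤ 2) :
    ∃ x ∈ Ioo (0 : ℝ) 1, ratioFun p a x = 0 ∧ x ^ (p - 1) * (2 + a) < 2 := by
  have hp1 : 0 < p - 1 := by linarith
  set c : ℝ := 2 / (2 + a) with hc
  have hc0 : 0 < c := by positivity
  have hc1 : c < 1 := by rw [hc, div_lt_one (by linarith)]; linarith
  set x₀ : ℝ := c ^ (1 / (p - 1)) with hx₀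
  have hx0 : 0 < x₀ := Real.rpow_pos_of_pos hc0 _
  have hx1 : x₀ < 1 := Real.rpow_lt_one hc0.le hc1 (by positivity)
  have hxc : x₀ ^ (p - 1) = c := by
    rw [hx₀, ← Real.rpow_mul hc0.le, one_div, inv_mul_cancel₀ hp1.ne', Real.rpow_one]
  have hxp : x₀ ^ p = c * x₀ := by
    rw [← hxc, ← Real.rpow_add_one hx0.ne']; congr 1; ring
  have hcp : 2 * p / (2 + a) = p * c := by rw [hc]; ring
  have hneg : ratioFun p a x₀ < 0 := by
    have hb := one_add_mul_self_lt_rpow_one_add (s := (1 - x₀) / x₀) (p := p)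
      (by have : 0 < (1 - x₀) / x₀ := div_pos (by linarith) hx0
          linarith) (div_pos (by linarith) hx0).ne' (by linarith)
    have h1 : 1 + (1 - x₀) / x₀ = 1 / x₀ := by field_simp; ring
    rw [h1, Real.div_rpow zero_le_one hx0.le, Real.one_rpow,
      lt_div_iff₀ (Real.rpow_pos_of_pos hx0 _), hxp] at hb
    have h2 : (1 + p * ((1 - x₀) / x₀)) * (c * x₀) = c * x₀ + p * c * (1 - x₀) := by
      field_simp
    unfold ratioFun
    rw [hcp, hxp]
    linarith
  have hpos : 0 < ratioFun p a 0 := by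
    unfold ratioFun
    rw [Real.zero_rpow (by linarith)]
    have : 1 < 2 * p / (2 + a) := by rw [lt_div_iff₀ (by linarith)]; linarith
    linarith
  have hcont : ContinuousOn (ratioFun p a) (Icc 0 x₀) := by
    unfold ratioFun
    have : Continuous fun x : ℝ => x ^ p := Real.continuous_rpow_const (by linarith)
    fun_prop
  obtain ⟨x, hx, hx'⟩ := intermediate_value_Ioo' hx0.le hcont (show (0 : ℝ) ∈ _ from ⟨hneg, hpos⟩)
  refine ⟨x, ⟨hx.1, hx.2.trans hx1⟩, hx', ?_⟩
  have : x ^ (p - 1) < c := hxc ▸ Real.rpow_lt_rpow hx.1.le hx.2 hp1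
  rwa [hc, lt_div_iff₀ (by linarith)] at this

theorem ratio_unique {p a x y : ℝ} (hp : 2 < p)
    (hx : x ∈ Ioo (0 : ℝ) 1) (hy : y ∈ Ioo (0 : ℝ) 1)
    (hfx : ratioFun p a x = 0) (hfy : ratioFun p a y = 0) : x = y := by
  have key : ∀ x y : ℝ, x ∈ Ioo (0 : ℝ) 1 → y ∈ Ioo (0 : ℝ) 1 → ratioFun p a x = 0 →
      ratioFun p a y = 0 → ¬ x < y := by
    intro x y hx hy hfx hfy hxy
    have hsc : StrictConvexOn ℝ (Ici (0 : ℝ)) fun x : ℝ => x ^ p :=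
      strictConvexOn_rpow (by linarith)
    have hx1 : 0 < 1 - x := by linarith [hx.2]
    have hc := hsc.2 (show x ∈ Ici (0 : ℝ) from le_of_lt hx.1)
      (show (1 : ℝ) ∈ Ici (0 : ℝ) from zero_le_one (α := ℝ)) hx.2.ne
      (div_pos (show 0 < 1 - y by linarith [hy.2]) hx1)
      (div_pos (show 0 < y - x by linarith) hx1)
      (by field_simp; ring)
    have h2 : (1 - y) / (1 - x) * x + (y - x) / (1 - x) * 1 = y := by field_simp; ring
    simp only [smul_eq_mul, Real.one_rpow] at hc
    rw [h2] at hc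
    unfold ratioFun at hfx hfy
    have hxp : x ^ p = 1 - 2 * p / (2 + a) * (1 - x) := by linarith
    have hyp : y ^ p = 1 - 2 * p / (2 + a) * (1 - y) := by linarith
    rw [hxp, hyp] at hc
    have h3 : (1 - y) / (1 - x) * (1 - 2 * p / (2 + a) * (1 - x)) + (y - x) / (1 - x) * 1
        = 1 - 2 * p / (2 + a) * (1 - y) := by
      generalize 2 * p / (2 + a) = q
      field_simp; ring
    linarith
  exact le_antisymm (not_lt.1 (key y x hy hx hfy hfx)) (not_lt.1 (key x y hx hy hfx hfy))

theorem existsUnique_ratio {p a : ℝ} (hp : 2 < p) (ha : 0 < a) (ha2 : a ≤ 2) :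
    ∃! x, x ∈ Ioo (0 : ℝ) 1 ∧ ratioFun p a x = 0 := by
  obtain ⟨x, hx, hfx, -⟩ := exists_ratio_lt hp ha ha2
  exact ⟨x, ⟨hx, hfx⟩, fun y hy => ratio_unique hp hy.1 hx hy.2 hfx⟩

theorem ratio_spec {p a : ℝ} (hp : 2 < p) (ha : 0 < a) (ha2 : a ≤ 2) :
    ratio p a ∈ Ioo (0 : ℝ) 1 ∧ ratioFun p a (ratio p a) = 0 ∧
      ratio p a ^ (p - 1) * (2 + a) < 2 := by
  obtain ⟨x, hx, hfx, hlt⟩ := exists_ratio_lt hp ha ha2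
  have hset : {y : ℝ | y ∈ Ioo (0 : ℝ) 1 ∧ ratioFun p a y = 0} = {x} := by
    ext y
    exact ⟨fun hy => ratio_unique hp hy.1 hx hy.2 hfx, fun hy => by
      rw [mem_singleton_iff] at hy; subst hy; exact ⟨hx, hfx⟩⟩
  have : ratio p a = x := by rw [ratio, hset, csInf_singleton]
  rw [this]
  exact ⟨hx, hfx, hlt⟩

theorem aSeq_mem {p : ℝ} (hp : 2 < p) (k : ℕ) : 0 < aSeq p k ∧ aSeq p k ≤ 2 := by
  induction k with
  | zero => simp [aSeq]
  | succ k ih =>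
    obtain ⟨hx, -, hlt⟩ := ratio_spec hp ih.1 ih.2
    have := mul_pos (Real.rpow_pos_of_pos hx.1 (p - 1)) (show 0 < 2 + aSeq p k by linarith [ih.1])
    simp only [aSeq]
    constructor <;> linarith

theorem δSeq_pos {p : ℝ} (hp : 2 < p) (k : ℕ) : 0 < δSeq p k := by
  induction k with
  | zero => simp [δSeq]
  | succ k ih =>
    exact mul_pos (ratio_spec hp (aSeq_mem hp k).1 (aSeq_mem hp k).2).1.1 ih

/-- The recurrence relations which characterize `(δ_k)` and `(a_k)`. -/
theorem δSeq_aSeq_spec {p : ℝ} (hp : 2 < p) (k : ℕ) :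
    δSeq p (k + 1) ∈ Ioo 0 (δSeq p k) ∧ aSeq p (k + 1) ∈ Ioo (0 : ℝ) 2 ∧
    2 * p / (2 + aSeq p k) * (1 - δSeq p (k + 1) / δSeq p k) - 1
      + (δSeq p (k + 1) / δSeq p k) ^ p = 0 ∧
    aSeq p (k + 1) = 2 - (δSeq p (k + 1) / δSeq p k) ^ (p - 1) * (2 + aSeq p k) := by
  obtain ⟨ha, ha2⟩ := aSeq_mem hp k
  obtain ⟨hx, hfx, hlt⟩ := ratio_spec hp ha ha2
  have hδ := δSeq_pos hp k
  have hdiv : δSeq p (k + 1) / δSeq p k = ratio p (aSeq p k) := by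
    simp only [δSeq]; field_simp
  have h0 := mul_pos (Real.rpow_pos_of_pos hx.1 (p - 1)) (show 0 < 2 + aSeq p k by linarith)
  refine ⟨⟨δSeq_pos hp _, ?_⟩, ⟨(aSeq_mem hp _).1, ?_⟩, ?_, ?_⟩
  · simp only [δSeq]; nlinarith [hx.2]
  · simp only [aSeq]; linarith
  · rw [hdiv]; exact hfx
  · rw [hdiv]; rfl

/-- The singular comparison curve `U_β(r) = (β log (1/r))^{1/p}`, used for `β > 0`, `0 < r ≤ 1`. -/
noncomputable def Ucurve (p β r : ℝ) : ℝ := (β * Real.log (1 / r)) ^ (1 / p)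

/-- The curve `V_L(r) = (2 log (1/r) - (1 - (1-m)/p) log (2 log (1/r)) + L)^{1/p}`,
used for small `r > 0`, where the base is positive. -/
noncomputable def Vcurve (p m L r : ℝ) : ℝ :=
  (2 * Real.log (1 / r) - (1 - (1 - m) / p) * Real.log (2 * Real.log (1 / r)) + L) ^ (1 / p)

/-- `(r_n) ⊂ (0,1)` is a sequence of centers of the `(k+1)`-th bubble of `(lam_n, μ_n, u_n)`:
`u_n(r_n)/μ_n → δ_k` and `p lam_n r_n² u_n(r_n)^{p-1} f(u_n(r_n)) → a_k²/2`. -/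
structure IsBubbleCenter (f : ℝ → ℝ) (p : ℝ) (lam μ : ℕ → ℝ) (u : ℕ → ℝ → ℝ) (k : ℕ)
    (r : ℕ → ℝ) : Prop where
  mem : ∀ n, r n ∈ Ioo (0 : ℝ) 1
  level : Tendsto (fun n => u n (r n) / μ n) atTop (𝓝 (δSeq p k))
  density : Tendsto (fun n => p * lam n * r n ^ 2 * u n (r n) ^ (p - 1) * f (u n (r n))) atTop
    (𝓝 (aSeq p k ^ 2 / 2))

/-- The number (possibly infinite) of zeros of `g` on `I`. -/
noncomputable def zeroCount (I : Set ℝ) (g : ℝ → ℝ) : ℕ∞ := {r ∈ I | g r = 0}.encard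

end SupercriticalBubbles

/-! In the variable `t = log r`, with `v(t) = u(e^t)` and `w = v'`, let `y = -(v^p)'` be `powSlope`
and let `φ` be `logDensity`, so that `e^φ = p lam r² u^{p-1} f(u)` where `u ≥ τ₀`. There, up to
errors of size `O(v^{-p})`, the equation becomes `φ' = 2 - y`, `y' = e^φ`, a Liouville equation with
first integral `E = (y-2)²/2 + e^φ`. The exact rate of `E` is `(log v)'` times a quantity bounded by
`K (E+1)`, so `E` changes only when the height `v` changes by a factor (`energy_compare`). At `-∞`
one has `E = 2 = a_0²/2`.

A bubble at relative height `δ` with `E ≈ a²/2` takes time `o(μ^p)`. The slope passes through `2`,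
where `e^φ = E ≈ a²/2` (`exists_peak`), and then approaches `2 + a`, while the density dies out
(`exists_exit`). After that, `v` is asymptotically linear in `t`: `v` is concave, hence below its
tangent, and `2t + v^p` is convex along a line, so the density stays negligible down to any height
at which the tangent predicts a negative exponent (`tendsto_of_exit`). At height `xμ` the exponent
is `φ ≈ μ^p δ^p ratioFun p a (x/δ)`. It is negative until `x/δ` reaches `ratio p a`, where the slope
is `ratio^{p-1} (2+a) < 2` and the next bubble enters (`exists_next_entry`). Induction from the
first bubble gives all bubbles and, between them, levels where `φ ≤ -c μ^p` with some `c > 0`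
(`exists_gap`).

Moreover `δ_k → 0` (`tendsto_δSeq`), and since `φ` is bounded at each center, this forces `log lam =
o(μ^p)`. Hence `2 log(1/r)` at a given level is known to leading order. In the gaps `u` lies below
some `U_{2-ε}`, and at the centers it lies above the relevant `V_L`. A function `U` between these
curves is therefore below `u` at every center and above it in every gap; it is also above `u` near
`r = 0`. The intermediate value theorem gives a zero of `u - U` on each side of every center, and
zeros belonging to different bubbles are at different heights. -/

namespace SupercriticalBubbles

/-! ### Logarithmic variables and the almost conserved Liouville energy. -/

/-- The logarithm of the density `p lam r² u^{p-1} f(u)` in the variable `t = log r`,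
with `Λ = p lam c₀`. -/
noncomputable def logDensity (p m Λ : ℝ) (v : ℝ → ℝ) (t : ℝ) : ℝ :=
  2 * t + Real.log Λ + (m + p - 1) * Real.log (v t) + v t ^ p

/-- The rate of decrease of `v ^ p`, where `w` is the derivative of `v`. -/
noncomputable def powSlope (p : ℝ) (v w : ℝ → ℝ) (t : ℝ) : ℝ := -(p * v t ^ (p - 1) * w t)

/-- The energy of the Liouville equation which governs the bubbles. -/
noncomputable def energy (p m Λ : ℝ) (v w : ℝ → ℝ) (t : ℝ) : ℝ :=
  (powSlope p v w t - 2) ^ 2 / 2 + Real.exp (logDensity p m Λ v t)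

/-- A radial solution in the variable `t = log r`, with derivative `w`. -/
structure EmdenProfile (p m τ Λ μ : ℝ) (v w : ℝ → ℝ) : Prop where
  pos : ∀ t < 0, 0 < v t
  hasDerivAt : ∀ t < 0, HasDerivAt v (w t) t
  deriv_nonpos : ∀ t < 0, w t ≤ 0
  deriv_anti : AntitoneOn w (Iio 0)
  hasDerivAt_deriv : ∀ t < 0, τ ≤ v t →
    HasDerivAt w (-(Real.exp (logDensity p m Λ v t) / (p * v t ^ (p - 1)))) t
  tendsto_atBot : Tendsto v atBot (𝓝 μ)
  tendsto_deriv : Tendsto w atBot (𝓝 0)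
  tendsto_zero : Tendsto v (𝓝[<] 0) (𝓝 0)

theorem rpow_eq_rpow_sub_one_mul {p x : ℝ} (hx : 0 < x) : x ^ p = x ^ (p - 1) * x := by
  rw [← Real.rpow_add_one hx.ne']; congr 1; ring

/-- The expression is quadratic in `y` and linear in `e`, as is the energy; the summand `1` absorbs
the region near `y = 2`, where the energy does not control `y`. This fixes the exponent `K` used in
all energy comparisons. -/
theorem abs_energy_rate_le {p m y e : ℝ} (hp : 2 < p) (he : 0 ≤ e) :
    |(p - 1) * (y - 2) * y + (m + p - 1) * e| ≤
      (4 * p + |m + p - 1|) * ((y - 2) ^ 2 / 2 + e + 1) := by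
  have h1 : |(m + p - 1) * e| ≤ |m + p - 1| * ((y - 2) ^ 2 / 2 + e + 1) := by
    rw [abs_mul, abs_of_nonneg he]
    exact mul_le_mul_of_nonneg_left (by nlinarith [sq_nonneg (y - 2)]) (abs_nonneg _)
  have h2 : |(y - 2) * y| ≤ 4 * ((y - 2) ^ 2 / 2 + e + 1) := by
    rw [abs_le]; constructor <;> nlinarith [sq_nonneg (y - 3), sq_nonneg (y - 1), sq_nonneg (y - 2)]
  have h3 : |(p - 1) * (y - 2) * y| ≤ 4 * p * ((y - 2) ^ 2 / 2 + e + 1) := by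
    rw [mul_assoc, abs_mul, abs_of_pos (by linarith : 0 < p - 1)]
    have h0 : 0 ≤ (y - 2) ^ 2 / 2 + e + 1 := by positivity
    nlinarith [abs_nonneg ((y - 2) * y)]
  refine (abs_add_le _ _).trans ?_
  linarith [add_mul (4 * p) |m + p - 1| ((y - 2) ^ 2 / 2 + e + 1)]

namespace EmdenProfile

variable {p m τ Λ μ : ℝ} {v w : ℝ → ℝ} {s t : ℝ}

theorem antitoneOn (P : EmdenProfile p m τ Λ μ v w) : AntitoneOn v (Iio 0) := by
  refine antitoneOn_of_deriv_nonpos (convex_Iio 0)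
    (fun t ht => (P.hasDerivAt t ht).continuousAt.continuousWithinAt)
    (fun t ht => ?_) (fun t ht => ?_) <;> rw [interior_Iio] at ht
  · exact (P.hasDerivAt t ht).differentiableAt.differentiableWithinAt
  · rw [(P.hasDerivAt t ht).deriv]; exact P.deriv_nonpos t ht

theorem continuousOn (P : EmdenProfile p m τ Λ μ v w) : ContinuousOn v (Iio 0) :=
  fun t ht => (P.hasDerivAt t ht).continuousAt.continuousWithinAt

theorem le_top (P : EmdenProfile p m τ Λ μ v w) (ht : t < 0) : v t ≤ μ := by
  refine ge_of_tendsto P.tendsto_atBot ?_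
  filter_upwards [eventually_le_atBot t] with s hs
  exact P.antitoneOn (lt_of_le_of_lt hs ht) ht hs

theorem top_pos (P : EmdenProfile p m τ Λ μ v w) : 0 < μ :=
  (P.pos (-1) (by norm_num)).trans_le (P.le_top (by norm_num))

theorem le_of_le (P : EmdenProfile p m τ Λ μ v w) (hst : s ≤ t) (ht : t < 0) : v t ≤ v s :=
  P.antitoneOn (lt_of_le_of_lt hst ht) ht hst

theorem lt_of_lt (P : EmdenProfile p m τ Λ μ v w) (hs : s < 0) (h : v t < v s) : s < t := by
  by_contra hts
  exact absurd (P.le_of_le (not_lt.1 hts) hs) (not_le.2 h)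

theorem exists_level (P : EmdenProfile p m τ Λ μ v w) {x : ℝ} (hx : 0 < x) (hxμ : x < μ) :
    ∃ t < 0, v t = x := by
  obtain ⟨s, hs, hs0⟩ := ((P.tendsto_atBot.eventually_const_lt hxμ).and
    (eventually_lt_atBot (0 : ℝ))).exists
  obtain ⟨t, ht, ht0⟩ := ((P.tendsto_zero.eventually_lt_const hx).and
    (self_mem_nhdsWithin)).exists
  have hst : s < t := P.lt_of_lt hs0 (ht.trans hs)
  obtain ⟨r, hr, hr'⟩ := intermediate_value_Icc' hst.le
    (P.continuousOn.mono fun r hr => lt_of_le_of_lt hr.2 ht0) ⟨ht.le, hs.le⟩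
  exact ⟨r, lt_of_le_of_lt hr.2 ht0, hr'⟩

theorem powSlope_nonneg (P : EmdenProfile p m τ Λ μ v w) (hp : 2 < p) (ht : t < 0) :
    0 ≤ powSlope p v w t := by
  have h1 := Real.rpow_pos_of_pos (P.pos t ht) (p - 1)
  have h2 := P.deriv_nonpos t ht
  unfold powSlope
  have : 0 ≤ p * v t ^ (p - 1) := by positivity
  nlinarith [mul_nonneg this (neg_nonneg.2 h2)]

theorem deriv_div_eq (P : EmdenProfile p m τ Λ μ v w) (hp : 2 < p) (ht : t < 0) :
    w t / v t = -(powSlope p v w t / (p * v t ^ p)) := by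
  have hv := P.pos t ht
  have h1 := Real.rpow_pos_of_pos hv (p - 1)
  unfold powSlope
  rw [rpow_eq_rpow_sub_one_mul (p := p) hv]
  field_simp

theorem hasDerivAt_rpow (P : EmdenProfile p m τ Λ μ v w) (ht : t < 0) :
    HasDerivAt (fun t => v t ^ p) (-powSlope p v w t) t := by
  convert (P.hasDerivAt t ht).rpow_const (p := p) (Or.inl (P.pos t ht).ne') using 1
  unfold powSlope; ring

theorem hasDerivAt_logDensity (P : EmdenProfile p m τ Λ μ v w) (hp : 2 < p) (ht : t < 0) :
    HasDerivAt (logDensity p m Λ v)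
      (2 - powSlope p v w t - (m + p - 1) * (powSlope p v w t / (p * v t ^ p))) t := by
  have h1 := ((((hasDerivAt_id t).const_mul 2).add_const (Real.log Λ)).add
    (((P.hasDerivAt t ht).log (P.pos t ht).ne').const_mul (m + p - 1))).add (P.hasDerivAt_rpow ht)
  rw [P.deriv_div_eq hp ht] at h1
  refine (h1.congr_deriv ?_)
  ring

theorem hasDerivAt_powSlope (P : EmdenProfile p m τ Λ μ v w) (hp : 2 < p) (ht : t < 0)
    (hτ : τ ≤ v t) :
    HasDerivAt (powSlope p v w) (Real.exp (logDensity p m Λ v t)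
      - (p - 1) / p * (powSlope p v w t ^ 2 / v t ^ p)) t := by
  have hv := P.pos t ht
  have h1 := (((P.hasDerivAt t ht).rpow_const (p := p - 1) (Or.inl hv.ne')).const_mul p).mul
    (P.hasDerivAt_deriv t ht hτ)
  refine h1.neg.congr_deriv ?_
  have hA := Real.rpow_pos_of_pos hv (p - 1 - 1)
  unfold powSlope
  rw [rpow_eq_rpow_sub_one_mul (p := p) hv, rpow_eq_rpow_sub_one_mul (p := p - 1) hv]
  generalize v t ^ (p - 1 - 1) = A at *
  field_simp
  ring

/-- The leading terms `(y-2) e^φ` and `(2-y) e^φ` cancel. What is left carries the factor `w / v =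
(log v)'`, which makes a Gronwall argument in `log v` possible. -/
theorem hasDerivAt_energy (P : EmdenProfile p m τ Λ μ v w) (hp : 2 < p) (ht : t < 0)
    (hτ : τ ≤ v t) :
    HasDerivAt (energy p m Λ v w) (w t / v t * ((p - 1) * (powSlope p v w t - 2) * powSlope p v w t
      + (m + p - 1) * Real.exp (logDensity p m Λ v t))) t := by
  have h1 := ((((P.hasDerivAt_powSlope hp ht hτ).sub_const 2).pow 2).div_const 2).add
    (P.hasDerivAt_logDensity hp ht).exp
  refine h1.congr_deriv ?_
  have hv := Real.rpow_pos_of_pos (P.pos t ht) p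
  rw [P.deriv_div_eq hp ht]
  generalize v t ^ p = A at *
  simp only [Nat.cast_ofNat]
  field_simp
  ring

theorem energy_nonneg : 0 ≤ energy p m Λ v w t := by unfold energy; positivity

theorem exp_le_energy : Real.exp (logDensity p m Λ v t) ≤ energy p m Λ v w t := by
  unfold energy; linarith [sq_nonneg (powSlope p v w t - 2)]

theorem powSlope_le (_ : 0 ≤ powSlope p v w t) :
    powSlope p v w t ≤ energy p m Λ v w t + 3 := by
  unfold energy
  nlinarith [sq_nonneg (powSlope p v w t - 3), Real.exp_pos (logDensity p m Λ v t)]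

/-- Gronwall's inequality with `log v` as time: `|dE / d(log v)| ≤ K (E+1)`, so `(E+1) v^K` and
`(E+1) v^{-K}` are monotone in opposite directions. -/
theorem energy_add_one_mul_rpow (P : EmdenProfile p m τ Λ μ v w) (hp : 2 < p) (hst : s ≤ t)
    (ht : t < 0) (hτ : τ ≤ v t) {K : ℝ} (hK : K = 4 * p + |m + p - 1|) :
    (energy p m Λ v w t + 1) * v t ^ K ≤ (energy p m Λ v w s + 1) * v s ^ K ∧
    (energy p m Λ v w s + 1) * v s ^ (-K) ≤ (energy p m Λ v w t + 1) * v t ^ (-K) := by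
  have hneg : ∀ r ∈ Icc s t, r < 0 := fun r hr => lt_of_le_of_lt hr.2 ht
  have hτr : ∀ r ∈ Icc s t, τ ≤ v r := fun r hr => hτ.trans (P.le_of_le hr.2 ht)
  have hd : ∀ k : ℝ, ∀ r ∈ Icc s t, HasDerivAt (fun r => (energy p m Λ v w r + 1) * v r ^ k)
      (v r ^ k * (w r / v r) * (((p - 1) * (powSlope p v w r - 2) * powSlope p v w r
      + (m + p - 1) * Real.exp (logDensity p m Λ v r)) + k * (energy p m Λ v w r + 1))) r := by
    intro k r hr
    have hv := P.pos r (hneg r hr)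
    refine ((((P.hasDerivAt_energy hp (hneg r hr) (hτr r hr)).add_const 1).mul
      ((P.hasDerivAt r (hneg r hr)).rpow_const (p := k) (Or.inl hv.ne')))).congr_deriv ?_
    rw [rpow_eq_rpow_sub_one_mul (p := k) hv]
    generalize v r ^ (k - 1) = A
    field_simp
  have hb : ∀ r, |(p - 1) * (powSlope p v w r - 2) * powSlope p v w r
      + (m + p - 1) * Real.exp (logDensity p m Λ v r)| ≤ K * (energy p m Λ v w r + 1) := by
    intro r; rw [hK]; exact abs_energy_rate_le hp (Real.exp_pos _).le
  have hwv : ∀ k : ℝ, ∀ r ∈ Icc s t, v r ^ k * (w r / v r) ≤ 0 := fun k r hr =>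
    mul_nonpos_of_nonneg_of_nonpos (Real.rpow_pos_of_pos (P.pos r (hneg r hr)) k).le
      (div_nonpos_of_nonpos_of_nonneg (P.deriv_nonpos r (hneg r hr)) (P.pos r (hneg r hr)).le)
  constructor
  · refine antitoneOn_of_deriv_nonpos (convex_Icc s t)
      (fun r hr => (hd K r hr).continuousAt.continuousWithinAt)
      (fun r hr => (hd K r (interior_subset hr)).differentiableAt.differentiableWithinAt)
      (fun r hr => ?_) (left_mem_Icc.2 hst) (right_mem_Icc.2 hst) hst
    rw [(hd K r (interior_subset hr)).deriv]
    exact mul_nonpos_of_nonpos_of_nonneg (hwv K r (interior_subset hr))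
      (by linarith [(abs_le.1 (hb r)).1])
  · refine monotoneOn_of_deriv_nonneg (convex_Icc s t)
      (fun r hr => (hd (-K) r hr).continuousAt.continuousWithinAt)
      (fun r hr => (hd (-K) r (interior_subset hr)).differentiableAt.differentiableWithinAt)
      (fun r hr => ?_) (left_mem_Icc.2 hst) (right_mem_Icc.2 hst) hst
    rw [(hd (-K) r (interior_subset hr)).deriv]
    exact mul_nonneg_of_nonpos_of_nonpos (hwv (-K) r (interior_subset hr))
      (by linarith [(abs_le.1 (hb r)).2])

/-- The energy varies slowly with the height of the solution. -/
theorem energy_compare (P : EmdenProfile p m τ Λ μ v w) (hp : 2 < p) (hst : s ≤ t)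
    (ht : t < 0) (hτ : τ ≤ v t) {K : ℝ} (hK : K = 4 * p + |m + p - 1|) :
    energy p m Λ v w t + 1 ≤ (energy p m Λ v w s + 1) * (v s / v t) ^ K ∧
    (energy p m Λ v w s + 1) * (v t / v s) ^ K ≤ energy p m Λ v w t + 1 := by
  obtain ⟨h1, h2⟩ := P.energy_add_one_mul_rpow hp hst ht hτ hK
  have hvt := P.pos t ht
  have hvs := P.pos s (lt_of_le_of_lt hst ht)
  have hvtK := Real.rpow_pos_of_pos hvt K
  have hvsK := Real.rpow_pos_of_pos hvs K
  rw [Real.rpow_neg hvt.le, Real.rpow_neg hvs.le, ← div_eq_mul_inv, ← div_eq_mul_inv,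
    div_le_div_iff₀ hvsK hvtK] at h2
  rw [Real.div_rpow hvt.le hvs.le, Real.div_rpow hvs.le hvt.le, mul_div_assoc', mul_div_assoc',
    le_div_iff₀ hvtK, div_le_iff₀ hvsK]
  exact ⟨h1, h2⟩

theorem tendsto_powSlope (P : EmdenProfile p m τ Λ μ v w) :
    Tendsto (powSlope p v w) atBot (𝓝 0) := by
  have := ((P.tendsto_atBot.rpow_const (p := p - 1) (Or.inl P.top_pos.ne')).const_mul p).mul
    P.tendsto_deriv
  have h := this.neg
  rw [mul_zero, neg_zero] at h
  exact h

theorem tendsto_exp_logDensity (P : EmdenProfile p m τ Λ μ v w) :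
    Tendsto (fun t => Real.exp (logDensity p m Λ v t)) atBot (𝓝 0) := by
  refine Real.tendsto_exp_atBot.comp ?_
  have h1 := ((P.tendsto_atBot.log P.top_pos.ne').const_mul (m + p - 1))
  have h2 := P.tendsto_atBot.rpow_const (p := p) (Or.inl P.top_pos.ne')
  have h3 : Tendsto (fun t : ℝ => 2 * t + Real.log Λ) atBot atBot :=
    tendsto_atBot_add_const_right _ _ (tendsto_id.const_mul_atBot (by norm_num))
  exact (h3.atBot_add h1).atBot_add h2

theorem tendsto_energy (P : EmdenProfile p m τ Λ μ v w) :
    Tendsto (energy p m Λ v w) atBot (𝓝 2) := by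
  have := (((P.tendsto_powSlope.sub_const 2).pow 2).div_const 2).add P.tendsto_exp_logDensity
  norm_num at this
  exact this

/-- The comparison is passed to the limit `s → -∞`, where `E + 1 → 3` and `v → μ`. -/
theorem energy_compare_top (P : EmdenProfile p m τ Λ μ v w) (hp : 2 < p)
    (ht : t < 0) (hτ : τ ≤ v t) {K : ℝ} (hK : K = 4 * p + |m + p - 1|) :
    energy p m Λ v w t + 1 ≤ 3 * (μ / v t) ^ K ∧
    3 * (v t / μ) ^ K ≤ energy p m Λ v w t + 1 := by
  have hvt := P.pos t ht
  have h1 : Tendsto (fun s => (energy p m Λ v w s + 1) * (v s / v t) ^ K) atBot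
      (𝓝 ((2 + 1) * (μ / v t) ^ K)) :=
    (P.tendsto_energy.add_const 1).mul ((P.tendsto_atBot.div_const _).rpow_const
      (Or.inl (div_pos P.top_pos hvt).ne'))
  have h2 : Tendsto (fun s => (energy p m Λ v w s + 1) * (v t / v s) ^ K) atBot
      (𝓝 ((2 + 1) * (v t / μ) ^ K)) :=
    (P.tendsto_energy.add_const 1).mul ((tendsto_const_nhds.div P.tendsto_atBot P.top_pos.ne').rpow_const
      (Or.inl (div_pos hvt P.top_pos).ne'))
  norm_num at h1 h2
  constructor
  · refine ge_of_tendsto h1 ?_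
    filter_upwards [eventually_le_atBot t] with s hs
    exact (P.energy_compare hp hs ht hτ hK).1
  · refine le_of_tendsto h2 ?_
    filter_upwards [eventually_le_atBot t] with s hs
    exact (P.energy_compare hp hs ht hτ hK).2

end EmdenProfile

/-! ### Differential inequalities within and between bubbles. -/

theorem mul_sub_le_of_hasDerivAt {F F' : ℝ → ℝ} {s t C : ℝ} (hst : s ≤ t)
    (hF : ∀ r ∈ Icc s t, HasDerivAt F (F' r) r) (hC : ∀ r ∈ Icc s t, C ≤ F' r) :
    C * (t - s) ≤ F t - F s := by
  refine (convex_Icc s t).mul_sub_le_image_sub_of_le_deriv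
    (fun r hr => (hF r hr).continuousAt.continuousWithinAt)
    (fun r hr => (hF r (interior_subset hr)).differentiableAt.differentiableWithinAt)
    (fun r hr => ?_) s (left_mem_Icc.2 hst) t (right_mem_Icc.2 hst) hst
  rw [(hF r (interior_subset hr)).deriv]
  exact hC r (interior_subset hr)

namespace EmdenProfile

variable {p m τ Λ μ : ℝ} {v w : ℝ → ℝ} {s t : ℝ}

/-- At great heights the lower order terms are small. -/
theorem error_le (P : EmdenProfile p m τ Λ μ v w) (hp : 2 < p) (hst : s ≤ t) (ht : t < 0)
    {Y ε : ℝ} (hY : powSlope p v w s ≤ Y)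
    (herr : |m + p - 1| * Y + p * Y ^ 2 ≤ ε * (p * v t ^ p)) :
    |(m + p - 1) * (powSlope p v w s / (p * v s ^ p))|
      + (p - 1) / p * (powSlope p v w s ^ 2 / v s ^ p) ≤ ε := by
  have hs := lt_of_le_of_lt hst ht
  have h0 := P.powSlope_nonneg hp hs
  have hvt := Real.rpow_pos_of_pos (P.pos t ht) p
  have hvs := Real.rpow_pos_of_pos (P.pos s hs) p
  have hv : v t ^ p ≤ v s ^ p :=
    Real.rpow_le_rpow (P.pos t ht).le (P.le_of_le hst ht) (by linarith)
  set y := powSlope p v w s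
  rw [abs_mul, abs_of_nonneg (by positivity : 0 ≤ y / (p * v s ^ p))]
  have h1 : |m + p - 1| * (y / (p * v s ^ p)) + (p - 1) / p * (y ^ 2 / v s ^ p)
      = (|m + p - 1| * y + (p - 1) * y ^ 2) / (p * v s ^ p) := by
    field_simp
  rw [h1, div_le_iff₀ (by positivity)]
  have h2 : |m + p - 1| * y ≤ |m + p - 1| * Y := mul_le_mul_of_nonneg_left hY (abs_nonneg _)
  have h3 : (p - 1) * y ^ 2 ≤ p * Y ^ 2 := by
    have : y ^ 2 ≤ Y ^ 2 := pow_le_pow_left₀ h0 hY 2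
    nlinarith [sq_nonneg y]
  have hε : 0 ≤ ε := by
    by_contra hε
    have : 0 ≤ |m + p - 1| * Y + p * Y ^ 2 := by
      have : 0 ≤ Y := h0.trans hY
      positivity
    nlinarith [mul_pos (by linarith : 0 < p) hvt]
  calc _ ≤ ε * (p * v t ^ p) := by linarith
    _ ≤ _ := by gcongr

/-- While `y ≤ 1`, the density grows at rate at least `3/4`, so it dominates everything accumulated
since `-∞`: the slope `∫ e^φ` and the height loss `∫ y`. When `y` first reaches `1`, the density is
thus not small, while the loss of height is still bounded by the density. -/
theorem top_rpow_le (P : EmdenProfile p m τ Λ μ v w) (hp : 2 < p) (ht : t < 0) (hτ : τ ≤ v t)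
    (hy : ∀ r ≤ t, powSlope p v w r ≤ 1)
    (herr : |m + p - 1| * 1 + p * 1 ^ 2 ≤ 1 / 4 * (p * v t ^ p)) :
    powSlope p v w t ≤ 2 * Real.exp (logDensity p m Λ v t) ∧
    μ ^ p ≤ v t ^ p + 4 * Real.exp (logDensity p m Λ v t) := by
  have hneg : ∀ r ≤ t, r < 0 := fun r hr => lt_of_le_of_lt hr ht
  have hτr : ∀ r ≤ t, τ ≤ v r := fun r hr => hτ.trans (P.le_of_le hr ht)
  -- `2 e^φ - y` tends to `0` at `-∞` and is nondecreasing: its derivative is at least `2 e^φ (2 - 1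
  -- - 1/4) - e^φ ≥ 0`.
  have key : ∀ r ≤ t, powSlope p v w r ≤ 2 * Real.exp (logDensity p m Λ v r) := by
    intro r hr
    have hlim : Tendsto (fun r => 2 * Real.exp (logDensity p m Λ v r) - powSlope p v w r)
        atBot (𝓝 0) := by
      simpa using (P.tendsto_exp_logDensity.const_mul 2).sub P.tendsto_powSlope
    refine sub_nonneg.1 (le_of_tendsto hlim ?_)
    filter_upwards [eventually_le_atBot r] with s hs
    have := mul_sub_le_of_hasDerivAt (C := 0) hs (fun x hx =>
      ((P.hasDerivAt_logDensity hp (hneg x (hx.2.trans hr))).exp.const_mul 2).sub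
        (P.hasDerivAt_powSlope hp (hneg x (hx.2.trans hr)) (hτr x (hx.2.trans hr))))
      (fun x hx => by
        have hx' := hx.2.trans hr
        have h1 := P.error_le hp hx' ht (hy x hx') herr
        have h2 := P.powSlope_nonneg hp (hneg x hx')
        have h3 := hy x hx'
        have h4 : 0 ≤ (p - 1) / p * (powSlope p v w x ^ 2 / v x ^ p) := by
          have := Real.rpow_pos_of_pos (P.pos x (hneg x hx')) p
          have : 0 < p - 1 := by linarith
          positivity
        have h5 := le_abs_self ((m + p - 1) * (powSlope p v w x / (p * v x ^ p)))
        nlinarith [Real.exp_pos (logDensity p m Λ v x)])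
    simp only [Pi.sub_apply] at this
    linarith
  refine ⟨key t le_rfl, ?_⟩
  have hlim : Tendsto (fun r => v r ^ p + 4 * Real.exp (logDensity p m Λ v r))
      atBot (𝓝 (μ ^ p)) := by
    simpa using (P.tendsto_atBot.rpow_const (p := p) (Or.inl P.top_pos.ne')).add
      (P.tendsto_exp_logDensity.const_mul 4)
  refine le_of_tendsto hlim ?_
  filter_upwards [eventually_le_atBot t] with s hs
  -- The derivative of `v^p + 4 e^φ` is at least `-y + 3 e^φ`, which is nonnegative by `key`.
  have := mul_sub_le_of_hasDerivAt (C := 0) hs (fun x hx =>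
      (P.hasDerivAt_rpow (hneg x hx.2)).add
        ((P.hasDerivAt_logDensity hp (hneg x hx.2)).exp.const_mul 4))
      (fun x hx => by
        have h1 := P.error_le hp hx.2 ht (hy x hx.2) herr
        have h3 := hy x hx.2
        have h4 : 0 ≤ (p - 1) / p * (powSlope p v w x ^ 2 / v x ^ p) := by
          have := Real.rpow_pos_of_pos (P.pos x (hneg x hx.2)) p
          have : 0 < p - 1 := by linarith
          positivity
        have h5 := le_abs_self ((m + p - 1) * (powSlope p v w x / (p * v x ^ p)))
        have h6 := key x hx.2
        nlinarith [Real.exp_pos (logDensity p m Λ v x)])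
  simp only [Pi.add_apply] at this
  linarith

theorem rpow_sub_rpow_le (P : EmdenProfile p m τ Λ μ v w) (hst : s ≤ t) (ht : t < 0)
    {Y : ℝ} (hY : ∀ r ∈ Icc s t, powSlope p v w r ≤ Y) :
    v s ^ p - v t ^ p ≤ Y * (t - s) := by
  have := mul_sub_le_of_hasDerivAt (C := -Y) hst
    (fun x hx => P.hasDerivAt_rpow (p := p) (lt_of_le_of_lt hx.2 ht))
    (fun x hx => neg_le_neg (hY x hx))
  linarith

/-- Since `φ' ≥ 2 - y - 1`, the density cannot fall faster than exponentially. This keeps `φ =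
o(μ^p)` at the exit of a bubble. -/
theorem logDensity_sub_le (P : EmdenProfile p m τ Λ μ v w) (hp : 2 < p) (hst : s ≤ t) (ht : t < 0)
    {Y : ℝ} (hY : ∀ r ∈ Icc s t, powSlope p v w r ≤ Y)
    (herr : |m + p - 1| * Y + p * Y ^ 2 ≤ 1 * (p * v t ^ p)) :
    logDensity p m Λ v s - logDensity p m Λ v t ≤ Y * (t - s) := by
  have := mul_sub_le_of_hasDerivAt (C := -Y) hst
    (fun x hx => P.hasDerivAt_logDensity hp (lt_of_le_of_lt hx.2 ht))
    (fun x hx => by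
        have h1 := P.error_le hp hx.2 ht (hY x hx) herr
        have h3 := hY x hx
        have h4 : 0 ≤ (p - 1) / p * (powSlope p v w x ^ 2 / v x ^ p) := by
          have := Real.rpow_pos_of_pos (P.pos x (lt_of_le_of_lt hx.2 ht)) p
          have : 0 < p - 1 := by linarith
          positivity
        have h5 := le_abs_self ((m + p - 1) * (powSlope p v w x / (p * v x ^ p)))
        linarith)
  linarith

/-- Before the slope reaches `2`, the density grows. -/
theorem duration_le_of_powSlope_le_two (P : EmdenProfile p m τ Λ μ v w) (hp : 2 < p)
    (hst : s ≤ t) (ht : t < 0) (hτ : τ ≤ v t) {β : ℝ}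
    (hY : ∀ r ∈ Icc s t, powSlope p v w r ≤ 2) (hE : ∀ r ∈ Icc s t, β ≤ energy p m Λ v w r)
    (herr : |m + p - 1| * 2 + p * 2 ^ 2 ≤ β / 2 * (p * v t ^ p)) :
    β / 2 * (t - s) ≤ logDensity p m Λ v t + 2 - logDensity p m Λ v s := by
  -- To leading order `(φ + y)' = 2 - y + e^φ`. As `0 ≤ 2 - y ≤ 2`, one has `2 - y ≥ (y-2)²/2`, so
  -- this is at least the energy; half of `β` pays for the errors.
  have := mul_sub_le_of_hasDerivAt (C := β / 2) hst
    (fun x hx => (P.hasDerivAt_logDensity hp (lt_of_le_of_lt hx.2 ht)).add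
      (P.hasDerivAt_powSlope hp (lt_of_le_of_lt hx.2 ht) (hτ.trans (P.le_of_le hx.2 ht))))
    (fun x hx => by
        have h1 := P.error_le hp hx.2 ht (hY x hx) herr
        have h3 := hY x hx
        have h5 := le_abs_self ((m + p - 1) * (powSlope p v w x / (p * v x ^ p)))
        have h6 := hE x hx
        have h7 := P.powSlope_nonneg hp (lt_of_le_of_lt hx.2 ht)
        unfold energy at h6
        nlinarith)
  simp only [Pi.add_apply] at this
  linarith [hY t (right_mem_Icc.2 hst), P.powSlope_nonneg hp (lt_of_le_of_lt hst ht)]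

/-- Once the slope is at least `2`, it stays so, and the density decays. -/
theorem duration_le_of_two_le_powSlope (P : EmdenProfile p m τ Λ μ v w) (hp : 2 < p)
    (hst : s ≤ t) (ht : t < 0) (hτ : τ ≤ v t) {β Y : ℝ} (hβ : 0 < β)
    (hYY : 4 ≤ Y) (hs : 2 ≤ powSlope p v w s)
    (hY : ∀ r ∈ Icc s t, powSlope p v w r ≤ Y) (hE : ∀ r ∈ Icc s t, β ≤ energy p m Λ v w r)
    (herr : |m + p - 1| * Y + p * Y ^ 2 ≤ β / Y * (p * v t ^ p)) :
    2 ≤ powSlope p v w t ∧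
    β / Y * (t - s) ≤ Y - logDensity p m Λ v t + logDensity p m Λ v s := by
  have hneg : ∀ r ∈ Icc s t, r < 0 := fun r hr => lt_of_le_of_lt hr.2 ht
  have hτr : ∀ r ∈ Icc s t, τ ≤ v r := fun r hr => hτ.trans (P.le_of_le hr.2 ht)
  have hβY : β / Y < β := div_lt_self hβ (by linarith)
  have herr' : ∀ r ∈ Icc s t, (p - 1) / p * (powSlope p v w r ^ 2 / v r ^ p) ≤ β / Y := by
    intro r hr
    have h1 := P.error_le hp hr.2 ht (hY r hr) herr
    linarith [abs_nonneg ((m + p - 1) * (powSlope p v w r / (p * v r ^ p)))]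
  have h2 : ∀ r ∈ Icc s t, 2 ≤ powSlope p v w r := by
    -- The level `2` cannot be crossed downwards: where `y = 2`, the energy is all density, so `y' ≥
    -- β - β / Y > 0`.
    have := image_le_of_deriv_right_lt_deriv_boundary' (f := fun r => -powSlope p v w r)
      (B := fun _ => (-2 : ℝ)) (B' := fun _ => 0) (a := s) (b := t)
      (fun r hr => (P.hasDerivAt_powSlope hp (hneg r hr)
        (hτr r hr)).neg.continuousAt.continuousWithinAt)
      (fun r hr => (P.hasDerivAt_powSlope hp (hneg r (Ico_subset_Icc_self hr))
        (hτr r (Ico_subset_Icc_self hr))).neg.hasDerivWithinAt)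
      (by simpa using hs) continuousOn_const (fun r _ => hasDerivWithinAt_const _ _ _)
      (fun r hr hr2 => by
        have hr' := Ico_subset_Icc_self hr
        have h3 := hE r hr'
        have h4 : powSlope p v w r = 2 := by linarith
        unfold energy at h3
        rw [h4] at h3
        have h5 := herr' r hr'
        linarith)
    intro r hr
    linarith [this hr]
  refine ⟨h2 t (right_mem_Icc.2 hst), ?_⟩
  have := mul_sub_le_of_hasDerivAt (C := β / Y) hst
    (fun x hx => (P.hasDerivAt_powSlope hp (hneg x hx) (hτr x hx)).sub
      (P.hasDerivAt_logDensity hp (hneg x hx)))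
    (fun x hx => by
      have h1 := P.error_le hp hx.2 ht (hY x hx) herr
      have h3 := hY x hx
      have h5 := neg_abs_le ((m + p - 1) * (powSlope p v w x / (p * v x ^ p)))
      have h6 := hE x hx
      have h7 := h2 x hx
      -- From `y - 2 ≤ Y` and `Y ≥ 2` the energy is at most `(Y/2) (y - 2 + e^φ)`. Half of the
      -- resulting bound absorbs the errors in `(y - φ)'`.
      have h8 : 2 * (β / Y) ≤ powSlope p v w x - 2 + Real.exp (logDensity p m Λ v x) := by
        unfold energy at h6
        rw [← mul_div_assoc, div_le_iff₀ (by linarith)]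
        nlinarith [Real.exp_pos (logDensity p m Λ v x)]
      linarith)
  simp only [Pi.sub_apply] at this
  linarith [hY t (right_mem_Icc.2 hst)]

/-- Concavity of `v`. The two tangents give opposite bounds for the time needed to descend by a
given height. -/
theorem le_tangent (P : EmdenProfile p m τ Λ μ v w) (hst : s ≤ t) (ht : t < 0) :
    -w s * (t - s) ≤ v s - v t ∧ v s - v t ≤ -w t * (t - s) := by
  have hneg : ∀ r ∈ Icc s t, r < 0 := fun r hr => lt_of_le_of_lt hr.2 ht
  have h1 := mul_sub_le_of_hasDerivAt (C := w t) hst (fun r hr => P.hasDerivAt r (hneg r hr))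
    (fun r hr => P.deriv_anti (hneg r hr) ht hr.2)
  have h2 := mul_sub_le_of_hasDerivAt (C := -w s) hst (fun r hr => (P.hasDerivAt r (hneg r hr)).neg)
    (fun r hr => neg_le_neg (P.deriv_anti (lt_of_le_of_lt hst ht) (hneg r hr) hr.1))
  simp only [Pi.neg_apply] at h2
  constructor <;> linarith

/-- Between two bubbles the density is negligible. -/
theorem logDensity_le_of_tangent (P : EmdenProfile p m τ Λ μ v w) (hp : 2 < p)
    (hst : s ≤ t) (ht : t < 0) (hv : v t < v s) (hw : w s < 0)
    (hψ : 2 * ((v s - v t) / -w s) + v t ^ p - v s ^ p ≤ 0) {r : ℝ} (hr : r ∈ Icc s t) :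
    logDensity p m Λ v r ≤ logDensity p m Λ v s + |m + p - 1| * Real.log (v s / v t) := by
  have hr0 : r < 0 := lt_of_le_of_lt hr.2 ht
  have hs0 : s < 0 := lt_of_le_of_lt hst ht
  have hvr := P.pos r hr0
  have hvs := P.pos s hs0
  have hvt := P.pos t ht
  have h1 := (P.le_tangent hr.1 hr0).1
  have hrt := P.le_of_le hr.2 ht
  have hsr := P.le_of_le hr.1 hr0
  set D := v s - v t with hD
  have hD0 : 0 < D := by linarith
  set l := -w s * (r - s) / D with hl
  have hl0 : 0 ≤ l := div_nonneg (mul_nonneg (by linarith) (by linarith [hr.1])) hD0.le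
  have hl1 : l ≤ 1 := by rw [hl, div_le_one hD0]; linarith
  have hlD : l * D = -w s * (r - s) := by rw [hl]; field_simp
  -- The fraction `l` locates time `r` on the tangent at `s`, with `l = 1` at height `v t`. Twice
  -- the elapsed time plus the `p`-th power of the height is convex along the tangent, and its
  -- excess over `v s ^ p` is nonpositive at both ends, hence also at `r`. Only the logarithmic term
  -- of `φ` remains.
  have hc := (convexOn_rpow (p := p) (by linarith)).2 (show v s ∈ Ici (0 : ℝ) from hvs.le)
    (show v t ∈ Ici (0 : ℝ) from hvt.le) (sub_nonneg.2 hl1) hl0 (by ring)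
  simp only [smul_eq_mul] at hc
  have h2 : v r ^ p ≤ ((1 - l) * v s + l * v t) ^ p :=
    Real.rpow_le_rpow hvr.le (by nlinarith) (by linarith)
  have h3 : l * (2 * (D / -w s)) = 2 * (r - s) := by
    have hw' := hw.ne
    rw [hl]; field_simp
  have h4 : v r ^ p - v s ^ p ≤ -(2 * (r - s)) := by
    nlinarith [mul_le_mul_of_nonneg_left hψ hl0]
  have h5 : (m + p - 1) * (Real.log (v r) - Real.log (v s))
      ≤ |m + p - 1| * Real.log (v s / v t) := by
    have h6 : |Real.log (v r) - Real.log (v s)| ≤ Real.log (v s / v t) := by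
      rw [Real.log_div hvs.ne' hvt.ne', abs_le]
      have := Real.log_le_log hvt hrt
      have := Real.log_le_log hvr hsr
      constructor <;> linarith
    calc _ ≤ |(m + p - 1) * (Real.log (v r) - Real.log (v s))| := le_abs_self _
      _ ≤ _ := by rw [abs_mul]; gcongr
  unfold logDensity
  linarith

/-- The uniform bound on the density is integrated in `w' = -e^φ / (p v^{p-1})`. The elapsed time
will be `O(μ^p)`, which is why bubble exits must satisfy `μ^p e^φ → 0`. -/
theorem deriv_sub_deriv_le (P : EmdenProfile p m τ Λ μ v w) (hp : 2 < p)
    (hst : s ≤ t) (ht : t < 0) (hτ : τ ≤ v t) (hv : v t < v s) (hw : w s < 0)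
    (hψ : 2 * ((v s - v t) / -w s) + v t ^ p - v s ^ p ≤ 0) :
    w s - w t ≤ Real.exp (logDensity p m Λ v s + |m + p - 1| * Real.log (v s / v t))
      / (p * v t ^ (p - 1)) * (t - s) := by
  have hneg : ∀ r ∈ Icc s t, r < 0 := fun r hr => lt_of_le_of_lt hr.2 ht
  have h1 := mul_sub_le_of_hasDerivAt
    (C := -(Real.exp (logDensity p m Λ v s + |m + p - 1| * Real.log (v s / v t))
      / (p * v t ^ (p - 1)))) hst
    (fun r hr => P.hasDerivAt_deriv r (hneg r hr) (hτ.trans (P.le_of_le hr.2 ht)))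
    (fun r hr => neg_le_neg (by
      have := Real.rpow_pos_of_pos (P.pos t ht) (p - 1)
      have h3 : v t ^ (p - 1) ≤ v r ^ (p - 1) :=
        Real.rpow_le_rpow (P.pos t ht).le (P.le_of_le hr.2 ht) (by linarith)
      gcongr
      exact P.logDensity_le_of_tangent hp hst ht hv hw hψ hr))
  linarith

end EmdenProfile

/-! ### Diagonal selection and first crossings. -/

theorem exists_seq_of_eventually {S : ℕ → ℝ → Prop} (h : ∀ᶠ n in atTop, ∃ t, S n t) :
    ∃ s : ℕ → ℝ, ∀ᶠ n in atTop, S n (s n) :=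
  ⟨fun n => Classical.epsilon (S n), h.mono fun _ hn => Classical.epsilon_spec hn⟩

/-- A diagonal argument: approximate solutions to any precision yield exact ones in the limit. -/
theorem exists_seq_tendsto_zero {S : ℕ → ℝ → Prop} {F : ℕ → ℝ → ℝ} (hF : ∀ n t, 0 ≤ F n t)
    (h : ∀ η > 0, ∀ᶠ n in atTop, ∃ t, S n t ∧ F n t < η) :
    ∃ s : ℕ → ℝ, (∀ᶠ n in atTop, S n (s n)) ∧ Tendsto (fun n => F n (s n)) atTop (𝓝 0) := by
  have hbdd : ∀ n, BddBelow (F n '' {t | S n t}) := fun n =>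
    ⟨0, by rintro _ ⟨t, -, rfl⟩; exact hF n t⟩
  -- The `n`-th point minimizes `F n` over the admissible set up to `1 / (n + 1)`, so it nearly
  -- matches any witness for a fixed precision.
  obtain ⟨s, hs⟩ := exists_seq_of_eventually
    (S := fun n t => S n t ∧ F n t < sInf (F n '' {t | S n t}) + 1 / ((n : ℝ) + 1)) <| by
      filter_upwards [h 1 one_pos] with n hn
      obtain ⟨t, ht, -⟩ := hn
      obtain ⟨_, ⟨t', ht', rfl⟩, hlt⟩ := exists_lt_of_csInf_lt
        (⟨_, t, ht, rfl⟩ : (F n '' {t | S n t}).Nonempty)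
        (lt_add_of_pos_right _ (by positivity : 0 < 1 / ((n : ℝ) + 1)))
      exact ⟨t', ht', hlt⟩
  refine ⟨s, hs.mono fun n hn => hn.1, ?_⟩
  rw [Metric.tendsto_nhds]
  intro η hη
  filter_upwards [hs, h (η / 2) (by positivity),
    tendsto_one_div_add_atTop_nhds_zero_nat.eventually_lt_const (by positivity : 0 < η / 2)]
    with n hn hn2 hn3
  obtain ⟨t, ht, htη⟩ := hn2
  have := csInf_le (hbdd n) (mem_image_of_mem _ ht)
  rw [Real.dist_eq, sub_zero, abs_of_nonneg (hF _ _)]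
  linarith [hn.2]

theorem tendsto_of_rpow {p δ : ℝ} (hp : 0 < p) (hδ : 0 ≤ δ) {x : ℕ → ℝ} (hx : ∀ᶠ n in atTop, 0 ≤ x n)
    (h : Tendsto (fun n => x n ^ p) atTop (𝓝 (δ ^ p))) : Tendsto x atTop (𝓝 δ) := by
  have h1 := h.rpow_const (p := p⁻¹) (Or.inr (by positivity))
  rw [Real.rpow_rpow_inv hδ hp.ne'] at h1
  refine h1.congr' ?_
  filter_upwards [hx] with n hn
  rw [Real.rpow_rpow_inv hn hp.ne']

/-- A function which starts below `1` at `-∞` and exceeds `1` has a first crossing. -/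
theorem exists_first_crossing {y : ℝ → ℝ} {r : ℝ} (hc : ContinuousOn y (Iic r))
    (h0 : ∀ᶠ x in atBot, y x < 1) (hr : 1 ≤ y r) : ∃ s ≤ r, y s = 1 ∧ ∀ x ≤ s, y x ≤ 1 := by
  obtain ⟨b, hb⟩ := eventually_atBot.1 h0
  have hbr : b ≤ r := by
    by_contra hbr
    linarith [hb r (not_le.1 hbr).le]
  have hc' : ContinuousOn y (Icc b r) := hc.mono fun x hx => hx.2
  have hclosed : IsClosed (Icc b r ∩ y ⁻¹' Ici 1) := hc'.preimage_isClosed_of_isClosed isClosed_Icc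
    isClosed_Ici
  obtain ⟨s, hs, hmin⟩ := (isCompact_Icc.of_isClosed_subset hclosed inter_subset_left).exists_isLeast
    ⟨r, right_mem_Icc.2 hbr, hr⟩
  have hlt : ∀ x < s, y x < 1 := by
    intro x hx
    by_contra hx1
    rcases le_total x b with hxb | hxb
    · exact hx1 (hb x hxb)
    · exact absurd (hmin ⟨⟨hxb, hx.le.trans hs.1.2⟩, not_lt.1 hx1⟩) (not_le.2 hx)
  have hs1 : y s = 1 := by
    obtain ⟨x, hx, hx1⟩ := intermediate_value_Icc hs.1.1 (hc'.mono (Icc_subset_Icc_right hs.1.2))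
      ⟨(hb b le_rfl).le, hs.2⟩
    rcases hx.2.lt_or_eq with hxs | rfl
    · exact absurd hx1 (hlt x hxs).ne
    · exact hx1
  refine ⟨s, hs.1.2, hs1, fun x hx => ?_⟩
  rcases hx.lt_or_eq with hxs | rfl
  · exact (hlt x hxs).le
  · exact hs1.le

/-! ### One bubble: entry, peak and exit. -/

/-- A sequence of radial solutions in logarithmic variables whose heights `μ n` blow up. -/
structure BlowupFamily (p m τ : ℝ) (Λ μ : ℕ → ℝ) (v w : ℕ → ℝ → ℝ) : Prop where
  two_lt : 2 < p
  profile : ∀ n, EmdenProfile p m τ (Λ n) (μ n) (v n) (w n)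
  tendsto_top : Tendsto μ atTop atTop

/-- Times `s n` at which a bubble of height `δ` and mass parameter `a` is about to form. -/
structure BubbleEntry (p m : ℝ) (Λ μ : ℕ → ℝ) (v w : ℕ → ℝ → ℝ) (δ a : ℝ) (s : ℕ → ℝ) : Prop where
  neg : ∀ᶠ n in atTop, s n < 0
  level : Tendsto (fun n => v n (s n) / μ n) atTop (𝓝 δ)
  energy : Tendsto (fun n => energy p m (Λ n) (v n) (w n) (s n)) atTop (𝓝 (a ^ 2 / 2))
  density : Tendsto (fun n => logDensity p m (Λ n) (v n) (s n) / μ n ^ p) atTop (𝓝 0)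
  slope : ∀ᶠ n in atTop, powSlope p (v n) (w n) (s n) ≤ 2

/-- Times `c n` at the center of a bubble. -/
structure BubblePeak (p m : ℝ) (Λ μ : ℕ → ℝ) (v w : ℕ → ℝ → ℝ) (δ a : ℝ) (c : ℕ → ℝ) : Prop where
  neg : ∀ᶠ n in atTop, c n < 0
  level : Tendsto (fun n => v n (c n) / μ n) atTop (𝓝 δ)
  slope : ∀ᶠ n in atTop, powSlope p (v n) (w n) (c n) = 2
  density : Tendsto (fun n => Real.exp (logDensity p m (Λ n) (v n) (c n))) atTop (𝓝 (a ^ 2 / 2))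

/-- Times `e n` just after a bubble, when the density has become negligible again. -/
structure BubbleExit (p m : ℝ) (Λ μ : ℕ → ℝ) (v w : ℕ → ℝ → ℝ) (δ a : ℝ) (e : ℕ → ℝ) : Prop where
  neg : ∀ᶠ n in atTop, e n < 0
  level : Tendsto (fun n => v n (e n) / μ n) atTop (𝓝 δ)
  slope : Tendsto (fun n => powSlope p (v n) (w n) (e n)) atTop (𝓝 (2 + a))
  density : Tendsto (fun n => logDensity p m (Λ n) (v n) (e n) / μ n ^ p) atTop (𝓝 0)
  exp_density : Tendsto (fun n => μ n ^ p * Real.exp (logDensity p m (Λ n) (v n) (e n)))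
    atTop (𝓝 0)

namespace BlowupFamily

variable {p m τ : ℝ} {Λ μ : ℕ → ℝ} {v w : ℕ → ℝ → ℝ} {δ a : ℝ}

theorem top_pos (B : BlowupFamily p m τ Λ μ v w) (n : ℕ) : 0 < μ n := (B.profile n).top_pos

theorem tendsto_rpow (B : BlowupFamily p m τ Λ μ v w) {q : ℝ} (hq : 0 < q) :
    Tendsto (fun n => μ n ^ q) atTop atTop := (tendsto_rpow_atTop hq).comp B.tendsto_top

theorem tendsto_const_div_rpow (B : BlowupFamily p m τ Λ μ v w) (C : ℝ) :
    Tendsto (fun n => C / μ n ^ p) atTop (𝓝 0) :=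
  (B.tendsto_rpow (by linarith [B.two_lt])).const_div_atTop C

theorem tendsto_div_rpow (B : BlowupFamily p m τ Λ μ v w) :
    Tendsto (fun n => μ n / μ n ^ p) atTop (𝓝 0) := by
  have h1 := (B.tendsto_rpow (q := p - 1) (by linarith [B.two_lt])).const_div_atTop 1
  refine h1.congr fun n => ?_
  have hμ := B.top_pos n
  have := Real.rpow_pos_of_pos hμ (p - 1)
  rw [rpow_eq_rpow_sub_one_mul (p := p) hμ]
  field_simp

/-- Supplies, at heights comparable to `μ n`, both the validity of the tail formula and the
smallness hypotheses `herr` of the differential inequalities. -/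
theorem eventually_le_mul_rpow (B : BlowupFamily p m τ Λ μ v w) {c ε : ℝ} (hc : 0 < c)
    (hε : 0 < ε) (A : ℝ) :
    ∀ᶠ n in atTop, ∀ t < 0, c * μ n ≤ v n t → τ ≤ v n t ∧ A ≤ ε * (p * v n t ^ p) := by
  have hp := B.two_lt
  filter_upwards [(B.tendsto_top.const_mul_atTop hc).eventually_ge_atTop τ,
    ((B.tendsto_rpow (q := p) (by linarith)).const_mul_atTop
      (by positivity : 0 < ε * (p * c ^ p))).eventually_ge_atTop A] with n h1 h2 t ht hv
  refine ⟨h1.trans hv, h2.trans ?_⟩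
  have hμ := B.top_pos n
  have : (c * μ n) ^ p ≤ v n t ^ p := Real.rpow_le_rpow (by positivity) hv (by linarith)
  rw [Real.mul_rpow hc.le hμ.le] at this
  calc _ = ε * (p * (c ^ p * μ n ^ p)) := by ring
    _ ≤ _ := by gcongr

/-- Slope and density are bounded as long as the height is comparable to the maximum. -/
theorem exists_bound (B : BlowupFamily p m τ Λ μ v w) {c : ℝ} (hc : 0 < c) :
    ∃ Y : ℝ, 4 ≤ Y ∧ ∀ᶠ n in atTop, ∀ t < 0, c * μ n ≤ v n t →
      powSlope p (v n) (w n) t ≤ Y ∧ Real.exp (logDensity p m (Λ n) (v n) t) ≤ Y ∧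
      logDensity p m (Λ n) (v n) t ≤ Y := by
  have hp := B.two_lt
  set K := 4 * p + |m + p - 1| with hK
  have hK0 : 0 ≤ K := by positivity
  refine ⟨3 * (1 / c) ^ K + 4, by linarith [Real.rpow_pos_of_pos (one_div_pos.2 hc) K], ?_⟩
  filter_upwards [B.eventually_le_mul_rpow hc one_pos 0] with n hn t ht hv
  have P := B.profile n
  have hvt := P.pos t ht
  have hμ := B.top_pos n
  have h1 := (P.energy_compare_top hp ht (hn t ht hv).1 hK).1
  have h2 : (μ n / v n t) ^ K ≤ (1 / c) ^ K := by
    refine Real.rpow_le_rpow (by positivity) ?_ hK0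
    rw [div_le_div_iff₀ hvt hc]; linarith
  have h3 := EmdenProfile.powSlope_le (m := m) (Λ := Λ n) (P.powSlope_nonneg hp ht)
  have h4 := EmdenProfile.exp_le_energy (p := p) (m := m) (Λ := Λ n) (v := v n) (w := w n) (t := t)
  have h5 := Real.add_one_le_exp (logDensity p m (Λ n) (v n) t)
  exact ⟨by linarith, by linarith, by linarith⟩

theorem tendsto_level_div (B : BlowupFamily p m τ Λ μ v w) {δ' : ℝ} (hδ : δ ≠ 0) {s t : ℕ → ℝ}
    (hs : Tendsto (fun n => v n (s n) / μ n) atTop (𝓝 δ))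
    (ht : Tendsto (fun n => v n (t n) / μ n) atTop (𝓝 δ')) :
    Tendsto (fun n => v n (t n) / v n (s n)) atTop (𝓝 (δ' / δ)) :=
  (ht.div hs hδ).congr fun n => div_div_div_cancel_right₀ (B.top_pos n).ne' _ _

theorem eventually_level_le {s : ℕ → ℝ} (B : BlowupFamily p m τ Λ μ v w)
    (hs : Tendsto (fun n => v n (s n) / μ n) atTop (𝓝 δ)) {c : ℝ} (hc : c < δ) :
    ∀ᶠ n in atTop, c * μ n < v n (s n) := by
  filter_upwards [hs.eventually_const_lt hc] with n hn
  exact (lt_div_iff₀ (B.top_pos n)).1 hn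

/-- The comparison factors `(v s / v t)^{±K}` tend to `1` when both times have the same limiting
relative height. A whole bubble happens at one relative height, so its energy limit can be read off
at any stage. -/
theorem energy_tendsto (B : BlowupFamily p m τ Λ μ v w) (hδ : 0 < δ) {E : ℝ} {s t : ℕ → ℝ}
    (hst : ∀ᶠ n in atTop, s n ≤ t n) (ht0 : ∀ᶠ n in atTop, t n < 0)
    (hs : Tendsto (fun n => v n (s n) / μ n) atTop (𝓝 δ))
    (ht : Tendsto (fun n => v n (t n) / μ n) atTop (𝓝 δ))
    (hE : Tendsto (fun n => energy p m (Λ n) (v n) (w n) (s n)) atTop (𝓝 E)) :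
    Tendsto (fun n => energy p m (Λ n) (v n) (w n) (t n)) atTop (𝓝 E) := by
  have hp := B.two_lt
  set K := 4 * p + |m + p - 1| with hK
  have h1 := (hE.add_const 1).mul
    ((B.tendsto_level_div hδ.ne' ht hs).rpow_const (p := K) (Or.inl (by positivity)))
  have h2 := (hE.add_const 1).mul
    ((B.tendsto_level_div hδ.ne' hs ht).rpow_const (p := K) (Or.inl (by positivity)))
  rw [div_self hδ.ne', Real.one_rpow, mul_one] at h1 h2
  have h3 : ∀ᶠ n in atTop, τ ≤ v n (t n) := by
    filter_upwards [B.eventually_level_le ht (half_lt_self hδ), ht0,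
      B.eventually_le_mul_rpow (half_pos hδ) one_pos 0] with n h4 h5 h6
    exact (h6 _ h5 h4.le).1
  have h4 := tendsto_of_tendsto_of_tendsto_of_le_of_le' h2 h1
    (f := fun n => energy p m (Λ n) (v n) (w n) (t n) + 1)
    (by filter_upwards [hst, ht0, h3] with n h5 h6 h7
        exact ((B.profile n).energy_compare hp h5 h6 h7 hK).2)
    (by filter_upwards [hst, ht0, h3] with n h5 h6 h7
        exact ((B.profile n).energy_compare hp h5 h6 h7 hK).1)
  simpa using h4.sub_const 1

theorem energy_tendsto_two (B : BlowupFamily p m τ Λ μ v w) {t : ℕ → ℝ}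
    (ht0 : ∀ᶠ n in atTop, t n < 0)
    (ht : Tendsto (fun n => v n (t n) / μ n) atTop (𝓝 1)) :
    Tendsto (fun n => energy p m (Λ n) (v n) (w n) (t n)) atTop (𝓝 2) := by
  have hp := B.two_lt
  set K := 4 * p + |m + p - 1| with hK
  have ht' : Tendsto (fun n => μ n / v n (t n)) atTop (𝓝 1) := by
    simpa using ht.inv₀ one_ne_zero
  have h1 := (ht'.rpow_const (p := K) (Or.inl one_ne_zero)).const_mul 3
  have h2 := (ht.rpow_const (p := K) (Or.inl one_ne_zero)).const_mul 3
  rw [Real.one_rpow, mul_one] at h1 h2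
  have h3 : ∀ᶠ n in atTop, τ ≤ v n (t n) := by
    filter_upwards [B.eventually_level_le ht one_half_lt_one, ht0,
      B.eventually_le_mul_rpow one_half_pos one_pos 0] with n h4 h5 h6
    exact (h6 _ h5 h4.le).1
  have h4 := tendsto_of_tendsto_of_tendsto_of_le_of_le' h2 h1
    (f := fun n => energy p m (Λ n) (v n) (w n) (t n) + 1)
    (by filter_upwards [ht0, h3] with n h6 h7
        exact ((B.profile n).energy_compare_top hp h6 h7 hK).2)
    (by filter_upwards [ht0, h3] with n h6 h7
        exact ((B.profile n).energy_compare_top hp h6 h7 hK).1)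
  have := h4.sub_const 1
  norm_num at this
  exact this

theorem eventually_le_energy (B : BlowupFamily p m τ Λ μ v w) (hδ : 0 < δ) {δ' E β : ℝ}
    (hδ' : 0 < δ') {s t : ℕ → ℝ} (ht0 : ∀ᶠ n in atTop, t n < 0)
    (hs : Tendsto (fun n => v n (s n) / μ n) atTop (𝓝 δ))
    (ht : Tendsto (fun n => v n (t n) / μ n) atTop (𝓝 δ'))
    (hE : Tendsto (fun n => energy p m (Λ n) (v n) (w n) (s n)) atTop (𝓝 E))
    (hβ : β + 1 < (E + 1) * (δ' / δ) ^ (4 * p + |m + p - 1|)) :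
    ∀ᶠ n in atTop, ∀ r ∈ Icc (s n) (t n), β ≤ energy p m (Λ n) (v n) (w n) r := by
  have hp := B.two_lt
  set K := 4 * p + |m + p - 1| with hK
  have hK0 : 0 ≤ K := by positivity
  have h2 := (hE.add_const 1).mul
    ((B.tendsto_level_div hδ.ne' hs ht).rpow_const (p := K) (Or.inr hK0))
  filter_upwards [h2.eventually_const_lt hβ, ht0, B.eventually_level_le ht (half_lt_self hδ'),
      B.eventually_le_mul_rpow (half_pos hδ') one_pos 0] with n h3 h4 h5 h6 r hr
  have P := B.profile n
  have hr0 := lt_of_le_of_lt hr.2 h4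
  have hvs := P.pos (s n) (lt_of_le_of_lt hr.1 hr0)
  have hvt := P.pos (t n) h4
  have hrt := P.le_of_le hr.2 h4
  have h7 := (P.energy_compare hp hr.1 hr0 ((h6 _ h4 h5.le).1.trans hrt) hK).2
  have h8 : (energy p m (Λ n) (v n) (w n) (s n) + 1) * (v n (t n) / v n (s n)) ^ K ≤
      (energy p m (Λ n) (v n) (w n) (s n) + 1) * (v n r / v n (s n)) ^ K := by
    have := EmdenProfile.energy_nonneg (p := p) (m := m) (Λ := Λ n) (v := v n) (w := w n)
      (t := s n)
    gcongr
  linarith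

theorem continuousOn_powSlope (B : BlowupFamily p m τ Λ μ v w) {n : ℕ} {t : ℝ} (ht : t < 0)
    (hτ : τ ≤ v n t) : ContinuousOn (powSlope p (v n) (w n)) (Iic t) := fun _ hr =>
  ((B.profile n).hasDerivAt_powSlope B.two_lt (lt_of_le_of_lt hr ht)
    (hτ.trans ((B.profile n).le_of_le hr ht))).continuousAt.continuousWithinAt

/-- The first bubble. -/
theorem exists_first_entry (B : BlowupFamily p m τ Λ μ v w) :
    ∃ s, BubbleEntry p m Λ μ v w 1 2 s := by
  have hp := B.two_lt
  have hp0 : 0 < p := by linarith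
  obtain ⟨Y, hY4, hY⟩ := B.exists_bound one_half_pos
  obtain ⟨s, hs⟩ := exists_seq_of_eventually (S := fun n s => s < 0 ∧
      powSlope p (v n) (w n) s = 1 ∧ 1 ≤ 2 * Real.exp (logDensity p m (Λ n) (v n) s) ∧
      logDensity p m (Λ n) (v n) s ≤ Y ∧ μ n ^ p ≤ v n s ^ p + 4 * Y) <| by
    have hlim : Tendsto (fun n => (1 - (1 / 2) ^ p) * μ n ^ p) atTop atTop :=
      (B.tendsto_rpow hp0).const_mul_atTop
        (sub_pos.2 (Real.rpow_lt_one (by norm_num) (by norm_num) hp0))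
    filter_upwards [hY, B.eventually_le_mul_rpow one_half_pos (by norm_num : (0 : ℝ) < 1 / 4)
      (|m + p - 1| * 1 + p * 1 ^ 2), hlim.eventually_gt_atTop (4 * Y)] with n h1 h2 h3
    have P := B.profile n
    have hμ := B.top_pos n
    obtain ⟨T, hT, hvT⟩ := P.exists_level (x := 1 / 2 * μ n) (by positivity) (by linarith)
    -- If the slope stayed below `1` down to half height, `top_rpow_le` would bound `(1 - 2^{-p})
    -- μ^p` by the constant `4 Y`.
    obtain ⟨r, hr, hr1⟩ : ∃ r ≤ T, 1 ≤ powSlope p (v n) (w n) r := by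
      by_contra! hcon
      have h4 := (P.top_rpow_le hp hT (h2 T hT hvT.ge).1 (fun r hr => (hcon r hr).le)
        (h2 T hT hvT.ge).2).2
      have h5 := (h1 T hT hvT.ge).2.1
      rw [hvT, Real.mul_rpow (by norm_num) hμ.le] at h4
      linarith
    have hr0 := lt_of_le_of_lt hr hT
    have hlow : ∀ x ≤ r, 1 / 2 * μ n ≤ v n x := fun x hx =>
      hvT.ge.trans (P.le_of_le (hx.trans hr) hT)
    obtain ⟨s, hsr, hs1, hs⟩ := exists_first_crossing
      (B.continuousOn_powSlope hr0 (h2 r hr0 (hlow r le_rfl)).1)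
      (P.tendsto_powSlope.eventually_lt_const one_pos) hr1
    have hs0 := lt_of_le_of_lt hsr hr0
    have h6 := P.top_rpow_le hp hs0 (h2 s hs0 (hlow s hsr)).1 hs (h2 s hs0 (hlow s hsr)).2
    have h7 := h1 s hs0 (hlow s hsr)
    exact ⟨s, hs0, hs1, by linarith [h6.1], h7.2.2, by linarith [h6.2]⟩
  have hneg : ∀ᶠ n in atTop, s n < 0 := hs.mono fun n hn => hn.1
  have hlev : Tendsto (fun n => v n (s n) / μ n) atTop (𝓝 1) := by
    refine tendsto_of_rpow hp0 zero_le_one (hneg.mono fun n hn =>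
      (div_pos ((B.profile n).pos _ hn) (B.top_pos n)).le) ?_
    rw [Real.one_rpow]
    have h1 := (B.tendsto_const_div_rpow (4 * Y)).const_sub 1
    rw [sub_zero] at h1
    refine tendsto_of_tendsto_of_tendsto_of_le_of_le' h1 tendsto_const_nhds ?_ ?_
    · filter_upwards [hs] with n hn
      have hμ := B.top_pos n
      have hμp := Real.rpow_pos_of_pos hμ p
      rw [Real.div_rpow ((B.profile n).pos _ hn.1).le hμ.le, le_div_iff₀ hμp, sub_mul,
        div_mul_cancel₀ _ hμp.ne']
      linarith [hn.2.2.2.2]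
    · filter_upwards [hneg] with n hn
      have hμ := B.top_pos n
      refine Real.rpow_le_one (div_pos ((B.profile n).pos _ hn) hμ).le ?_ hp0.le
      rw [div_le_one hμ]
      exact (B.profile n).le_top hn
  refine ⟨s, hneg, hlev, ?_, ?_, hs.mono fun n hn => by linarith [hn.2.1]⟩
  · have := B.energy_tendsto_two hneg hlev
    norm_num
    exact this
  · refine tendsto_of_tendsto_of_tendsto_of_le_of_le'
      (B.tendsto_const_div_rpow (Real.log (1 / 2))) (B.tendsto_const_div_rpow Y) ?_ ?_
    · filter_upwards [hs] with n hn
      have hμp := Real.rpow_pos_of_pos (B.top_pos n) p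
      gcongr
      rw [Real.log_le_iff_le_exp (by norm_num)]
      linarith [hn.2.2.1]
    · filter_upwards [hs] with n hn
      have hμp := Real.rpow_pos_of_pos (B.top_pos n) p
      gcongr
      exact hn.2.2.2.1

theorem tendsto_level_rpow (B : BlowupFamily p m τ Λ μ v w) {s : ℕ → ℝ} (h0 : ∀ᶠ n in atTop, s n < 0)
    (hs : Tendsto (fun n => v n (s n) / μ n) atTop (𝓝 δ)) :
    Tendsto (fun n => v n (s n) ^ p / μ n ^ p) atTop (𝓝 (δ ^ p)) := by
  refine (hs.rpow_const (p := p) (Or.inr (by linarith [B.two_lt]))).congr' ?_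
  filter_upwards [h0] with n hn
  rw [Real.div_rpow ((B.profile n).pos _ hn).le (B.top_pos n).le]

/-- As long as the slope is below `2`, time is bounded by the growth of `φ`, which is `o(μ^p)` from
the entry on. So `v^p` loses only `o(μ^p)` before the slope reaches `2`, and there the energy equals
the density. -/
theorem exists_peak (B : BlowupFamily p m τ Λ μ v w) (hδ : 0 < δ) (hδ1 : δ ≤ 1) (ha : 0 < a)
    {s : ℕ → ℝ} (hs : BubbleEntry p m Λ μ v w δ a s) :
    ∃ c, BubblePeak p m Λ μ v w δ a c := by
  have hp := B.two_lt
  have hp0 : 0 < p := by linarith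
  obtain ⟨c, hc, hcδ⟩ := exists_seq_tendsto_zero
    (S := fun n c => s n ≤ c ∧ c < 0 ∧ powSlope p (v n) (w n) c = 2)
    (F := fun n c => |v n c / μ n - δ|) (fun n c => abs_nonneg _) <| by
    intro η hη
    -- Half of the limiting energy; the other half allows for the energy lost on the way down to a
    -- level `δ'` slightly below `δ`.
    set β := a ^ 2 / 4 with hβ
    have hβ0 : 0 < β := by positivity
    obtain ⟨δ', hδ'1, hδ'2, hδ'3, hδ'4⟩ : ∃ δ', β + 1 <
        (a ^ 2 / 2 + 1) * (δ' / δ) ^ (4 * p + |m + p - 1|) ∧ 0 < δ' ∧ δ - η < δ' ∧ δ' < δ := by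
      have hcont : Tendsto (fun x => (a ^ 2 / 2 + 1) * (x / δ) ^ (4 * p + |m + p - 1|)) (𝓝[<] δ)
          (𝓝 ((a ^ 2 / 2 + 1) * (δ / δ) ^ (4 * p + |m + p - 1|))) :=
        ((((tendsto_id.mono_left nhdsWithin_le_nhds).div_const δ).rpow_const
          (Or.inr (by positivity))).const_mul _)
      rw [div_self hδ.ne', Real.one_rpow, mul_one] at hcont
      have h1 : β + 1 < a ^ 2 / 2 + 1 := by linarith
      obtain ⟨x, hx⟩ := (((hcont.eventually_const_lt h1).and
        ((lt_mem_nhds hδ).filter_mono nhdsWithin_le_nhds)).and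
        (((lt_mem_nhds (sub_lt_self δ hη)).filter_mono nhdsWithin_le_nhds).and
          self_mem_nhdsWithin)).exists
      exact ⟨x, hx.1.1, hx.1.2, hx.2.1, hx.2.2⟩
    choose T hT hvT using fun n => (B.profile n).exists_level (x := δ' * μ n)
      (mul_pos hδ'2 (B.top_pos n)) (by nlinarith [B.top_pos n])
    obtain ⟨Y, hY4, hY⟩ := B.exists_bound hδ'2
    have hTlev : Tendsto (fun n => v n (T n) / μ n) atTop (𝓝 δ') := by
      refine tendsto_const_nhds.congr fun n => ?_
      rw [hvT n, mul_div_cancel_right₀ _ (B.top_pos n).ne']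
    have hT0 : ∀ᶠ n in atTop, T n < 0 := Eventually.of_forall hT
    have hlim : Tendsto (fun n => v n (s n) ^ p / μ n ^ p - v n (T n) ^ p / μ n ^ p
        - (4 / β) * ((Y + 2) / μ n ^ p - logDensity p m (Λ n) (v n) (s n) / μ n ^ p)) atTop
        (𝓝 (δ ^ p - δ' ^ p - (4 / β) * (0 - 0))) :=
      ((B.tendsto_level_rpow hs.neg hs.level).sub (B.tendsto_level_rpow hT0 hTlev)).sub
        (((B.tendsto_const_div_rpow (Y + 2)).sub hs.density).const_mul _)
    have hpos : 0 < δ ^ p - δ' ^ p - (4 / β) * (0 - 0) := by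
      have := Real.rpow_lt_rpow hδ'2.le hδ'4 hp0
      linarith
    filter_upwards [hs.neg, hs.slope, B.eventually_level_le hs.level hδ'4,
      hs.level.eventually_lt_const (lt_add_of_pos_right δ hη), hY,
      B.eventually_le_energy hδ hδ'2 hT0 hs.level hTlev hs.energy hδ'1,
      B.eventually_le_mul_rpow hδ'2 (half_pos hβ0) (|m + p - 1| * 2 + p * 2 ^ 2),
      hlim.eventually_const_lt hpos] with n h1 h2 h3 h4 h5 h6 h7 h8
    have P := B.profile n
    have hμ := B.top_pos n
    have hμp := Real.rpow_pos_of_pos hμ p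
    have hsT : s n ≤ T n := (P.lt_of_lt h1 (by rw [hvT]; exact h3)).le
    have h7T := h7 (T n) (hT n) (hvT n).ge
    -- Otherwise descending from `δ μ` to `δ' μ` would take time of order `μ^p`, against the
    -- duration bound `o(μ^p)`.
    obtain ⟨r, hr, hr2⟩ : ∃ r ∈ Icc (s n) (T n), 2 ≤ powSlope p (v n) (w n) r := by
      by_contra! hcon
      have h9 := P.duration_le_of_powSlope_le_two hp hsT (hT n) h7T.1
        (fun r hr => (hcon r hr).le) h6 h7T.2
      have h10 := P.rpow_sub_rpow_le hsT (hT n) (fun r hr => (hcon r hr).le)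
      have h11 := (h5 (T n) (hT n) (hvT n).ge).2.2
      have h12 : v n (s n) ^ p - v n (T n) ^ p ≤
          4 / β * (Y + 2 - logDensity p m (Λ n) (v n) (s n)) := by
        rw [div_mul_eq_mul_div, le_div_iff₀ hβ0]
        nlinarith
      have h13 : (v n (s n) ^ p / μ n ^ p - v n (T n) ^ p / μ n ^ p
        - (4 / β) * ((Y + 2) / μ n ^ p - logDensity p m (Λ n) (v n) (s n) / μ n ^ p)) * μ n ^ p
        = v n (s n) ^ p - v n (T n) ^ p
          - 4 / β * (Y + 2 - logDensity p m (Λ n) (v n) (s n)) := by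
        field_simp
      nlinarith [mul_pos h8 hμp]
    obtain ⟨c, hc, hc2⟩ := intermediate_value_Icc hr.1
      ((B.continuousOn_powSlope (hT n) h7T.1).mono fun x hx => hx.2.trans hr.2) ⟨h2, hr2⟩
    have hcT := hc.2.trans hr.2
    have hc0 := lt_of_le_of_lt hcT (hT n)
    refine ⟨c, ⟨hc.1, hc0, hc2⟩, ?_⟩
    have h14 := P.le_of_le hc.1 hc0
    have h15 := P.le_of_le hcT (hT n)
    rw [hvT] at h15
    have h16 : v n c / μ n ≤ v n (s n) / μ n := by gcongr
    have h17 : δ' ≤ v n c / μ n := (le_div_iff₀ hμ).2 h15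
    rw [abs_lt]
    constructor <;> linarith
  have hc0 : ∀ᶠ n in atTop, c n < 0 := hc.mono fun n hn => hn.2.1
  have hlev : Tendsto (fun n => v n (c n) / μ n) atTop (𝓝 δ) := by
    have := (tendsto_zero_iff_abs_tendsto_zero _).2 hcδ
    simpa using this.add_const δ
  refine ⟨c, hc0, hlev, hc.mono fun n hn => hn.2.2, ?_⟩
  refine (B.energy_tendsto hδ (hc.mono fun n hn => hn.1) hc0 hs.level hlev hs.energy).congr' ?_
  filter_upwards [hc] with n hn
  unfold energy
  rw [hn.2.2]
  ring

/-- The exit is taken at time `μ n` after the peak. This is long enough for the density to decay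
like `e^{-(β/Y) μ}`, which beats `μ^p`, and short enough, as `μ = o(μ^p)`, to change neither the
relative height nor `φ / μ^p` in the limit. -/
theorem exists_exit (B : BlowupFamily p m τ Λ μ v w) (hδ : 0 < δ) (hδ1 : δ ≤ 1) (ha : 0 < a)
    {c : ℕ → ℝ} (hc : BubblePeak p m Λ μ v w δ a c) :
    ∃ e, BubbleExit p m Λ μ v w δ a e := by
  have hp := B.two_lt
  have hp0 : 0 < p := by linarith
  set β := a ^ 2 / 4 with hβ
  have hβ0 : 0 < β := by positivity
  have hδ2 := half_pos hδ
  have hδ2' := half_lt_self hδ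
  obtain ⟨Y, hY4, hY⟩ := B.exists_bound hδ2
  choose T hT hvT using fun n => (B.profile n).exists_level (x := δ / 2 * μ n)
    (mul_pos hδ2 (B.top_pos n)) (by nlinarith [B.top_pos n])
  have hTlev : Tendsto (fun n => v n (T n) / μ n) atTop (𝓝 (δ / 2)) := by
    refine tendsto_const_nhds.congr fun n => ?_
    rw [hvT n, mul_div_cancel_right₀ _ (B.top_pos n).ne']
  have hT0 : ∀ᶠ n in atTop, T n < 0 := Eventually.of_forall hT
  have hφc : Tendsto (fun n => logDensity p m (Λ n) (v n) (c n)) atTop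
      (𝓝 (Real.log (a ^ 2 / 2))) :=
    (hc.density.log (by positivity)).congr fun n => Real.log_exp _
  have hcE : Tendsto (fun n => energy p m (Λ n) (v n) (w n) (c n)) atTop (𝓝 (a ^ 2 / 2)) := by
    refine hc.density.congr' ?_
    filter_upwards [hc.slope] with n hn
    unfold energy
    rw [hn]
    ring
  have hYc : ∀ᶠ n in atTop, c n + μ n ≤ T n ∧ ∀ r ∈ Icc (c n) (T n), r < 0 ∧
      δ / 2 * μ n ≤ v n r ∧
      powSlope p (v n) (w n) r ≤ Y ∧ logDensity p m (Λ n) (v n) r ≤ Y := by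
    have hlim := ((B.tendsto_level_rpow hc.neg hc.level).sub (B.tendsto_level_rpow hT0 hTlev)).sub
      (B.tendsto_div_rpow.const_mul Y)
    have hpos : 0 < δ ^ p - (δ / 2) ^ p - Y * 0 := by
      have := Real.rpow_lt_rpow hδ2.le hδ2' hp0
      linarith
    filter_upwards [hc.neg, hY, B.eventually_level_le hc.level hδ2',
      hlim.eventually_const_lt hpos] with n h1 h2 h3 h4
    have P := B.profile n
    have hμp := Real.rpow_pos_of_pos (B.top_pos n) p
    have hcT : c n ≤ T n := (P.lt_of_lt h1 (by rw [hvT]; exact h3)).le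
    have h5 : ∀ r ∈ Icc (c n) (T n), r < 0 ∧ δ / 2 * μ n ≤ v n r ∧
        powSlope p (v n) (w n) r ≤ Y ∧ logDensity p m (Λ n) (v n) r ≤ Y := by
      intro r hr
      have hr0 := lt_of_le_of_lt hr.2 (hT n)
      have hv : δ / 2 * μ n ≤ v n r := (hvT n).ge.trans (P.le_of_le hr.2 (hT n))
      have := h2 r hr0 hv
      exact ⟨hr0, hv, this.1, this.2.2⟩
    refine ⟨?_, h5⟩
    have h6 := P.rpow_sub_rpow_le hcT (hT n) (fun r hr => (h5 r hr).2.2.1)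
    have h7 : (v n (c n) ^ p / μ n ^ p - v n (T n) ^ p / μ n ^ p - Y * (μ n / μ n ^ p)) * μ n ^ p
        = v n (c n) ^ p - v n (T n) ^ p - Y * μ n := by
      field_simp
    have h8 := mul_pos h4 hμp
    rw [h7] at h8
    nlinarith
  have hsub : ∀ᶠ n in atTop, Icc (c n) (c n + μ n) ⊆ Icc (c n) (T n) :=
    hYc.mono fun n hn => Icc_subset_Icc_right hn.1
  have hce : ∀ n, c n ≤ c n + μ n := fun n => by linarith [B.top_pos n]
  have he0 : ∀ᶠ n in atTop, c n + μ n < 0 := hYc.mono fun n hn => lt_of_le_of_lt hn.1 (hT n)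
  have hlev : Tendsto (fun n => v n (c n + μ n) / μ n) atTop (𝓝 δ) := by
    refine tendsto_of_rpow hp0 hδ.le (he0.mono fun n hn =>
      (div_pos ((B.profile n).pos _ hn) (B.top_pos n)).le) ?_
    have h1 := (B.tendsto_level_rpow hc.neg hc.level).sub (B.tendsto_div_rpow.const_mul Y)
    rw [mul_zero, sub_zero] at h1
    refine tendsto_of_tendsto_of_tendsto_of_le_of_le' h1 (B.tendsto_level_rpow hc.neg hc.level) ?_ ?_
    · filter_upwards [hYc, hsub, he0] with n h2 h3 h4
      have hμ := B.top_pos n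
      have hμp := Real.rpow_pos_of_pos hμ p
      have P := B.profile n
      have h5 := P.rpow_sub_rpow_le (hce n) h4 (fun r hr => (h2.2 r (h3 hr)).2.2.1)
      rw [Real.div_rpow (P.pos _ h4).le hμ.le, ← mul_div_assoc, ← sub_div]
      gcongr
      linarith
    · filter_upwards [he0] with n h4
      have hμ := B.top_pos n
      have P := B.profile n
      rw [Real.div_rpow (P.pos _ h4).le hμ.le]
      have := P.pos _ h4
      have := P.le_of_le (hce n) h4
      gcongr
  have hE := B.energy_tendsto hδ (Eventually.of_forall hce) he0 hc.level hlev hcE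
  have hβE := B.eventually_le_energy hδ hδ he0 hc.level hlev hcE (β := β) (by
    rw [div_self hδ.ne', Real.one_rpow, mul_one]; nlinarith)
  have hmain : ∀ᶠ n in atTop, 2 ≤ powSlope p (v n) (w n) (c n + μ n) ∧
      logDensity p m (Λ n) (v n) (c n + μ n) ≤ 2 * Y - β / Y * μ n ∧
      logDensity p m (Λ n) (v n) (c n) - Y * μ n ≤ logDensity p m (Λ n) (v n) (c n + μ n) := by
    filter_upwards [hYc, hsub, he0, hβE, hc.slope,
      B.eventually_le_mul_rpow hδ2 (by positivity : 0 < β / Y) (|m + p - 1| * Y + p * Y ^ 2),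
      B.eventually_le_mul_rpow hδ2 one_pos (|m + p - 1| * Y + p * Y ^ 2)]
      with n h2 h3 h4 h5 h6 h7 h8
    have P := B.profile n
    have h9 : δ / 2 * μ n ≤ v n (c n + μ n) := (h2.2 _ (h3 (right_mem_Icc.2 (hce n)))).2.1
    obtain ⟨h10, h11⟩ := P.duration_le_of_two_le_powSlope hp (hce n) h4 (h7 _ h4 h9).1 hβ0 hY4 h6.ge
      (fun r hr => (h2.2 r (h3 hr)).2.2.1) h5 (h7 _ h4 h9).2
    have h12 := P.logDensity_sub_le hp (hce n) h4
      (fun r hr => (h2.2 r (h3 hr)).2.2.1) (h8 _ h4 h9).2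
    have h13 := (h2.2 _ (h3 (left_mem_Icc.2 (hce n)))).2.2.2
    rw [add_sub_cancel_left] at h11 h12
    exact ⟨h10, by linarith, by linarith⟩
  have hexp : Tendsto (fun n => μ n ^ p *
      Real.exp (logDensity p m (Λ n) (v n) (c n + μ n))) atTop (𝓝 0) := by
    have h1 := ((tendsto_rpow_mul_exp_neg_mul_atTop_nhds_zero p (β / Y) (by positivity)).comp
      B.tendsto_top).const_mul (Real.exp (2 * Y))
    rw [mul_zero] at h1
    refine squeeze_zero' (Eventually.of_forall fun n => ?_) ?_ h1
    · have := Real.rpow_pos_of_pos (B.top_pos n) p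
      positivity
    · filter_upwards [hmain] with n hn
      have hμp := Real.rpow_pos_of_pos (B.top_pos n) p
      have h2 := Real.exp_le_exp.2 hn.2.1
      have h3 : Real.exp (2 * Y - β / Y * μ n) = Real.exp (2 * Y) * Real.exp (-(β / Y) * μ n) := by
        rw [← Real.exp_add]; congr 1; ring
      simp only [Function.comp]
      rw [h3] at h2
      nlinarith
  have hexp0 : Tendsto (fun n => Real.exp (logDensity p m (Λ n) (v n) (c n + μ n))) atTop
      (𝓝 0) := by
    have h1 := hexp.mul (B.tendsto_const_div_rpow 1)
    rw [mul_zero] at h1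
    refine h1.congr fun n => ?_
    have := Real.rpow_pos_of_pos (B.top_pos n) p
    field_simp
  refine ⟨fun n => c n + μ n, he0, hlev, ?_, ?_, hexp⟩
  -- The density being gone, the energy `a²/2` is all in `(y-2)²/2`; the sign `y ≥ 2` selects the
  -- root `2 + a`.
  · have h1 := (((hE.sub hexp0).const_mul 2).sqrt).const_add 2
    rw [sub_zero, mul_div_cancel₀ _ two_ne_zero, Real.sqrt_sq ha.le] at h1
    refine h1.congr' ?_
    filter_upwards [hmain] with n hn
    have h2 : 2 * (energy p m (Λ n) (v n) (w n) (c n + μ n)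
        - Real.exp (logDensity p m (Λ n) (v n) (c n + μ n)))
        = (powSlope p (v n) (w n) (c n + μ n) - 2) ^ 2 := by
      unfold energy; ring
    rw [h2, Real.sqrt_sq (by linarith [hn.1])]
    ring
  · have h1 := (hφc.mul (B.tendsto_const_div_rpow 1)).sub (B.tendsto_div_rpow.const_mul Y)
    rw [mul_zero, mul_zero, sub_zero] at h1
    refine tendsto_of_tendsto_of_tendsto_of_le_of_le' h1 (B.tendsto_const_div_rpow (2 * Y)) ?_ ?_
    · filter_upwards [hmain] with n hn
      have hμp := Real.rpow_pos_of_pos (B.top_pos n) p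
      rw [← mul_div_assoc, ← mul_div_assoc, mul_one, ← sub_div]
      gcongr
      exact hn.2.2
    · filter_upwards [hmain] with n hn
      have hμ := B.top_pos n
      have hμp := Real.rpow_pos_of_pos hμ p
      gcongr
      have : 0 ≤ β / Y * μ n := by positivity
      linarith [hn.2.1]

end BlowupFamily

/-! ### The linear regime between bubbles and the induction over all bubbles. -/

theorem ratioFun_neg {p a x : ℝ} (hp : 2 < p) (ha : 0 < a) (ha2 : a ≤ 2)
    (hx : x ∈ Ioo (ratio p a) 1) : ratioFun p a x < 0 := by
  obtain ⟨hr, hfr, -⟩ := ratio_spec hp ha ha2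
  set r := ratio p a
  have hr1 : 0 < 1 - r := by linarith [hr.2]
  -- `ratioFun` is strictly convex and vanishes at `ratio p a` and at `1`, so it is negative in
  -- between.
  have hc := (strictConvexOn_rpow (p := p) (by linarith)).2
    (show r ∈ Ici (0 : ℝ) from hr.1.le) (show (1 : ℝ) ∈ Ici (0 : ℝ) from zero_le_one (α := ℝ))
    hr.2.ne (div_pos (sub_pos.2 hx.2) hr1) (div_pos (sub_pos.2 hx.1) hr1) (by field_simp; ring)
  have h2 : (1 - x) / (1 - r) * r + (x - r) / (1 - r) * 1 = x := by field_simp; ring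
  simp only [smul_eq_mul, Real.one_rpow] at hc
  rw [h2] at hc
  unfold ratioFun at hfr ⊢
  have hrp : r ^ p = 1 - 2 * p / (2 + a) * (1 - r) := by linarith
  rw [hrp] at hc
  have h3 : (1 - x) / (1 - r) * (1 - 2 * p / (2 + a) * (1 - r)) + (x - r) / (1 - r) * 1
      = 1 - 2 * p / (2 + a) * (1 - x) := by
    generalize 2 * p / (2 + a) = q
    field_simp; ring
  linarith

theorem continuous_ratioFun {p a : ℝ} (hp : 0 < p) : Continuous (ratioFun p a) := by
  unfold ratioFun
  have : Continuous fun x : ℝ => x ^ p := Real.continuous_rpow_const hp.le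
  fun_prop

namespace BlowupFamily

variable {p m τ : ℝ} {Λ μ : ℕ → ℝ} {v w : ℕ → ℝ → ℝ} {δ a : ℝ}

/-- Between two bubbles the solution is asymptotically linear. -/
theorem tendsto_of_exit (B : BlowupFamily p m τ Λ μ v w) (hδ : 0 < δ) (ha : 0 < a)
    {e : ℕ → ℝ} (he : BubbleExit p m Λ μ v w δ a e) {x : ℝ} (hx0 : 0 < x) (hxδ : x < δ)
    (hx : ratioFun p a (x / δ) < 0) {T : ℕ → ℝ}
    (hT : ∀ᶠ n in atTop, T n < 0 ∧ v n (T n) = x * μ n) :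
    Tendsto (fun n => powSlope p (v n) (w n) (T n)) atTop (𝓝 ((2 + a) * (x / δ) ^ (p - 1))) ∧
    Tendsto (fun n => logDensity p m (Λ n) (v n) (T n) / μ n ^ p) atTop
      (𝓝 (δ ^ p * ratioFun p a (x / δ))) := by
  have hp := B.two_lt
  have hp0 : 0 < p := by linarith
  have hδq := Real.rpow_pos_of_pos hδ (p - 1)
  have hxq := Real.rpow_pos_of_pos hx0 (p - 1)
  have hδp := Real.rpow_pos_of_pos hδ p
  have hT0 : ∀ᶠ n in atTop, T n < 0 := hT.mono fun n hn => hn.1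
  have hTlev : Tendsto (fun n => v n (T n) / μ n) atTop (𝓝 x) := by
    refine tendsto_const_nhds.congr' ?_
    filter_upwards [hT] with n hn
    rw [hn.2, mul_div_cancel_right₀ _ (B.top_pos n).ne']
  have hmul : ∀ n, μ n ^ (p - 1) * μ n = μ n ^ p := fun n =>
    (rpow_eq_rpow_sub_one_mul (B.top_pos n)).symm
  set A := (2 + a) / (p * δ ^ (p - 1)) with hA
  have hA0 : 0 < A := by positivity
  have hσ : Tendsto (fun n => -w n (e n) * μ n ^ (p - 1)) atTop (𝓝 A) := by
    have h1 := he.slope.div ((he.level.rpow_const (p := p - 1) (Or.inl hδ.ne')).const_mul p)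
      (by positivity)
    refine h1.congr' ?_
    filter_upwards [he.neg] with n hn
    have hv := (B.profile n).pos _ hn
    have hμ := B.top_pos n
    have hvq := Real.rpow_pos_of_pos hv (p - 1)
    have hμq := Real.rpow_pos_of_pos hμ (p - 1)
    simp only [Pi.div_apply]
    rw [Real.div_rpow hv.le hμ.le]
    unfold powSlope
    field_simp
  have hD : Tendsto (fun n => (v n (e n) - v n (T n)) / μ n) atTop (𝓝 (δ - x)) :=
    (he.level.sub hTlev).congr fun n => (sub_div _ _ _).symm
  have hDσ : Tendsto (fun n => (v n (e n) - v n (T n)) / -w n (e n) / μ n ^ p) atTop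
      (𝓝 ((δ - x) / A)) := by
    refine (hD.div hσ hA0.ne').congr fun n => ?_
    have hμq := Real.rpow_pos_of_pos (B.top_pos n) (p - 1)
    simp only [Pi.div_apply]
    rw [← hmul n, div_div, div_div]
    congr 1; ring
  -- Here `A` is the limit of the descent speed times `μ^{p-1}`, so `(δ - x) / A` is the predicted
  -- duration in units of `μ^p`. This identity is the origin of `ratioFun`.
  have hlim0 : 2 * ((δ - x) / A) + x ^ p - δ ^ p = δ ^ p * ratioFun p a (x / δ) := by
    unfold ratioFun
    rw [Real.div_rpow hx0.le hδ.le, hA, rpow_eq_rpow_sub_one_mul (p := p) hδ]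
    field_simp
    ring
  have hψ : ∀ᶠ n in atTop, 2 * ((v n (e n) - v n (T n)) / -w n (e n)) + v n (T n) ^ p
      - v n (e n) ^ p ≤ 0 := by
    have h1 := ((hDσ.const_mul 2).add (B.tendsto_level_rpow hT0 hTlev)).sub
      (B.tendsto_level_rpow he.neg he.level)
    rw [hlim0] at h1
    filter_upwards [h1.eventually_lt_const (mul_neg_of_pos_of_neg hδp hx)] with n hn
    have hμp := Real.rpow_pos_of_pos (B.top_pos n) p
    rw [← mul_div_assoc, ← add_div, ← sub_div, div_lt_iff₀ hμp, zero_mul] at hn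
    exact hn.le
  have hw : ∀ᶠ n in atTop, w n (e n) < 0 := by
    filter_upwards [hσ.eventually_const_lt hA0] with n hn
    have hμq := Real.rpow_pos_of_pos (B.top_pos n) (p - 1)
    nlinarith
  have hv : ∀ᶠ n in atTop, v n (T n) < v n (e n) := by
    filter_upwards [B.eventually_level_le he.level hxδ, hT] with n h1 h2
    rw [h2.2]; exact h1
  have heT : ∀ᶠ n in atTop, e n ≤ T n := by
    filter_upwards [hv, he.neg] with n h1 h2
    exact ((B.profile n).lt_of_lt h2 h1).le
  have hlog : Tendsto (fun n => Real.log (v n (e n) / v n (T n))) atTop (𝓝 (Real.log (δ / x))) :=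
    (B.tendsto_level_div hx0.ne' hTlev he.level).log (by positivity)
  have hdur : ∀ᶠ n in atTop, (T n - e n) / μ n ^ p ≤
      (v n (e n) - v n (T n)) / -w n (e n) / μ n ^ p := by
    filter_upwards [heT, hT0, hw] with n h1 h2 h3
    have hμp := Real.rpow_pos_of_pos (B.top_pos n) p
    gcongr
    rw [le_div_iff₀ (by linarith), mul_comm]
    exact ((B.profile n).le_tangent h1 h2).1
  -- Concavity gives the lower bound. In the upper one, the excess over the speed at `e n` is of
  -- order `μ^p e^φ` times a rescaled duration that stays bounded, hence vanishes.
  have hwT : Tendsto (fun n => -w n (T n) * μ n ^ (p - 1)) atTop (𝓝 A) := by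
    have h1 : Tendsto (fun n => μ n ^ p * Real.exp (logDensity p m (Λ n) (v n) (e n))
        * Real.exp (|m + p - 1| * Real.log (v n (e n) / v n (T n))) / (p * x ^ (p - 1))
        * ((v n (e n) - v n (T n)) / -w n (e n) / μ n ^ p)) atTop (𝓝 (0
        * Real.exp (|m + p - 1| * Real.log (δ / x)) / (p * x ^ (p - 1)) * ((δ - x) / A))) :=
      ((he.exp_density.mul ((Real.continuous_exp.tendsto _).comp (hlog.const_mul _))).div_const
        _).mul hDσ
    have h2 := hσ.add h1
    rw [zero_mul, zero_div, zero_mul, add_zero] at h2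
    have hτ : ∀ᶠ n in atTop, τ ≤ v n (T n) := by
      filter_upwards [hT, B.eventually_le_mul_rpow hx0 one_pos 0] with n h3 h4
      exact (h4 _ h3.1 h3.2.ge).1
    refine tendsto_of_tendsto_of_tendsto_of_le_of_le' hσ h2 ?_ ?_
    · filter_upwards [heT, hT] with n h3 h4
      have hμq := Real.rpow_pos_of_pos (B.top_pos n) (p - 1)
      have := (B.profile n).deriv_anti (lt_of_le_of_lt h3 h4.1) h4.1 h3
      gcongr
    · filter_upwards [heT, hT, hw, hψ, hv, hτ, hdur] with n h3 h4 h5 h6 h7 h8 h9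
      have hμ := B.top_pos n
      have hμq := Real.rpow_pos_of_pos hμ (p - 1)
      have hμp := Real.rpow_pos_of_pos hμ p
      have h10 := (B.profile n).deriv_sub_deriv_le hp h3 h4.1 h8 h7 h5 h6
      set G := Real.exp (|m + p - 1| * Real.log (v n (e n) / v n (T n)))
      set H := Real.exp (logDensity p m (Λ n) (v n) (e n))
      have hG : 0 < G := Real.exp_pos _
      have hH : 0 < H := Real.exp_pos _
      have hvTq : v n (T n) ^ (p - 1) = x ^ (p - 1) * μ n ^ (p - 1) := by
        rw [h4.2, Real.mul_rpow hx0.le hμ.le]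
      rw [Real.exp_add, hvTq] at h10
      have h11 : (w n (e n) - w n (T n)) * μ n ^ (p - 1) ≤
          μ n ^ p * H * G / (p * x ^ (p - 1)) * ((T n - e n) / μ n ^ p) := by
        have h12 := mul_le_mul_of_nonneg_right h10 hμq.le
        refine h12.trans_eq ?_
        field_simp
        ring
      have h13 : μ n ^ p * H * G / (p * x ^ (p - 1)) * ((T n - e n) / μ n ^ p) ≤
          μ n ^ p * H * G / (p * x ^ (p - 1)) *
            ((v n (e n) - v n (T n)) / -w n (e n) / μ n ^ p) := by
        gcongr
      linarith
  -- The duration lies between the predictions of the tangents at the two ends, whose rescaled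
  -- speeds have the same limit.
  have hdurT : Tendsto (fun n => (T n - e n) / μ n ^ p) atTop (𝓝 ((δ - x) / A)) := by
    have h1 : Tendsto (fun n => (v n (e n) - v n (T n)) / -w n (T n) / μ n ^ p) atTop
        (𝓝 ((δ - x) / A)) := by
      refine (hD.div hwT hA0.ne').congr fun n => ?_
      simp only [Pi.div_apply]
      rw [← hmul n, div_div, div_div]
      congr 1; ring
    refine tendsto_of_tendsto_of_tendsto_of_le_of_le' h1 hDσ ?_ hdur
    filter_upwards [heT, hT, hwT.eventually_const_lt hA0] with n h2 h3 h4
    have hμq := Real.rpow_pos_of_pos (B.top_pos n) (p - 1)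
    have hμp := Real.rpow_pos_of_pos (B.top_pos n) p
    have h5 : 0 < -w n (T n) := by
      by_contra hcon
      nlinarith
    gcongr
    rw [div_le_iff₀ h5, mul_comm]
    exact ((B.profile n).le_tangent h2 h3.1).2
  constructor
  · have h1 := hwT.const_mul (p * x ^ (p - 1))
    have h2 : p * x ^ (p - 1) * A = (2 + a) * (x / δ) ^ (p - 1) := by
      rw [Real.div_rpow hx0.le hδ.le, hA]
      field_simp
    rw [h2] at h1
    refine h1.congr' ?_
    filter_upwards [hT] with n hn
    unfold powSlope
    rw [hn.2, Real.mul_rpow hx0.le (B.top_pos n).le]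
    ring
  · have h1 := (((he.density.add (hdurT.const_mul 2)).add (B.tendsto_level_rpow hT0 hTlev)).sub
      (B.tendsto_level_rpow he.neg he.level)).sub
      ((hlog.const_mul (m + p - 1)).mul (B.tendsto_const_div_rpow 1))
    rw [zero_add, hlim0, mul_zero, sub_zero] at h1
    refine h1.congr' ?_
    filter_upwards [hT0, he.neg] with n h2 h3
    have hμp := Real.rpow_pos_of_pos (B.top_pos n) p
    rw [Real.log_div ((B.profile n).pos _ h3).ne' ((B.profile n).pos _ h2).ne']
    unfold logDensity
    field_simp
    ring

theorem tendsto_atBot_of_div_rpow (B : BlowupFamily p m τ Λ μ v w) {φ : ℕ → ℝ} {l : ℝ} (hl : l < 0)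
    (h : Tendsto (fun n => φ n / μ n ^ p) atTop (𝓝 l)) : Tendsto φ atTop atBot := by
  refine (h.neg_mul_atTop hl (B.tendsto_rpow (q := p) (by linarith [B.two_lt]))).congr fun n => ?_
  exact div_mul_cancel₀ _ (Real.rpow_pos_of_pos (B.top_pos n) p).ne'

/-- The linear regime is controlled only at levels strictly above `ratio p a * δ`. Letting the level
decrease to this value and taking a diagonal sequence gives times at which `φ = o(μ^p)` but the
density still tends to `0`, so the energy is `(2 - b)²/2` with `b` the limiting slope. -/
theorem exists_next_entry (B : BlowupFamily p m τ Λ μ v w) (hδ : 0 < δ) (hδ1 : δ ≤ 1) (ha : 0 < a)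
    (ha2 : a ≤ 2) {e : ℕ → ℝ} (he : BubbleExit p m Λ μ v w δ a e) :
    ∃ s, BubbleEntry p m Λ μ v w (ratio p a * δ)
      (2 - ratio p a ^ (p - 1) * (2 + a)) s := by
  have hp := B.two_lt
  have hp0 : 0 < p := by linarith
  obtain ⟨hr, hfr, hlt⟩ := ratio_spec hp ha ha2
  set r := ratio p a with hrdef
  set b := r ^ (p - 1) * (2 + a) with hb
  obtain ⟨s, hs, hsF⟩ := exists_seq_tendsto_zero (S := fun n t => t < 0)
    (F := fun n t => |v n t / μ n - r * δ| + |powSlope p (v n) (w n) t - b|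
      + |logDensity p m (Λ n) (v n) t / μ n ^ p|
      + |Real.exp (logDensity p m (Λ n) (v n) t)|) (fun n t => by positivity) <| by
    intro η hη
    have hcont : ContinuousAt (fun x => |x - r * δ| + |(2 + a) * (x / δ) ^ (p - 1) - b|
        + |δ ^ p * ratioFun p a (x / δ)|) (r * δ) := by
      have h1 : Continuous fun x : ℝ => x ^ (p - 1) := Real.continuous_rpow_const (by linarith)
      have h2 := continuous_ratioFun (a := a) hp0
      fun_prop
    have h0 : |r * δ - r * δ| + |(2 + a) * (r * δ / δ) ^ (p - 1) - b|
        + |δ ^ p * ratioFun p a (r * δ / δ)| = 0 := by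
      rw [mul_div_cancel_right₀ _ hδ.ne', hfr, hb]
      simp [mul_comm]
    have hlim := hcont.tendsto
    rw [h0] at hlim
    have hrδ : r * δ < δ := by nlinarith [hr.2]
    obtain ⟨x, hx, hx1, hx2⟩ := (((hlim.eventually_lt_const hη).filter_mono
      nhdsWithin_le_nhds).and (((gt_mem_nhds hrδ).filter_mono nhdsWithin_le_nhds).and
        (self_mem_nhdsWithin : Ioi (r * δ) ∈ 𝓝[>] (r * δ)))).exists
    have hx0 : 0 < x := (mul_pos hr.1 hδ).trans hx2
    have hxneg : ratioFun p a (x / δ) < 0 :=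
      ratioFun_neg hp ha ha2 ⟨(lt_div_iff₀ hδ).2 hx2, (div_lt_one hδ).2 hx1⟩
    choose T hT hvT using fun n => (B.profile n).exists_level (x := x * μ n)
      (mul_pos hx0 (B.top_pos n)) (by nlinarith [B.top_pos n])
    obtain ⟨h3, h4⟩ := B.tendsto_of_exit hδ ha he hx0 hx1 hxneg
      (Eventually.of_forall fun n => ⟨hT n, hvT n⟩)
    have h5 := Real.tendsto_exp_atBot.comp (B.tendsto_atBot_of_div_rpow
      (mul_neg_of_pos_of_neg (Real.rpow_pos_of_pos hδ p) hxneg) h4)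
    have hTlev : Tendsto (fun n => v n (T n) / μ n) atTop (𝓝 x) := by
      refine tendsto_const_nhds.congr fun n => ?_
      rw [hvT n, mul_div_cancel_right₀ _ (B.top_pos n).ne']
    have h6 := (((hTlev.sub_const (r * δ)).abs.add (h3.sub_const b).abs).add h4.abs).add h5.abs
    rw [abs_zero, add_zero] at h6
    filter_upwards [h6.eventually_lt_const hx] with n hn
    exact ⟨T n, hT n, hn⟩
  have habs : ∀ A B C D : ℝ, ‖A‖ ≤ |A| + |B| + |C| + |D| ∧ ‖B‖ ≤ |A| + |B| + |C| + |D| ∧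
      ‖C‖ ≤ |A| + |B| + |C| + |D| ∧ ‖D‖ ≤ |A| + |B| + |C| + |D| := by
    intro A B C D
    simp only [Real.norm_eq_abs]
    have hA := abs_nonneg A
    have hB := abs_nonneg B
    have hC := abs_nonneg C
    have hD := abs_nonneg D
    exact ⟨by linarith, by linarith, by linarith, by linarith⟩
  have hlev : Tendsto (fun n => v n (s n) / μ n) atTop (𝓝 (r * δ)) :=
    tendsto_sub_nhds_zero_iff.1 (squeeze_zero_norm (fun n => (habs _ _ _ _).1) hsF)
  have hslope : Tendsto (fun n => powSlope p (v n) (w n) (s n)) atTop (𝓝 b) :=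
    tendsto_sub_nhds_zero_iff.1 (squeeze_zero_norm (fun n => (habs _ _ _ _).2.1) hsF)
  have hdens : Tendsto (fun n => logDensity p m (Λ n) (v n) (s n) / μ n ^ p) atTop (𝓝 0) :=
    squeeze_zero_norm (fun n => (habs _ _ _ _).2.2.1) hsF
  have hexp : Tendsto (fun n => Real.exp (logDensity p m (Λ n) (v n) (s n))) atTop (𝓝 0) :=
    squeeze_zero_norm (fun n => (habs _ _ _ _).2.2.2) hsF
  refine ⟨s, hs, hlev, ?_, hdens, (hslope.eventually_lt_const hlt).mono fun n hn => hn.le⟩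
  have h1 := (((hslope.sub_const 2).pow 2).div_const 2).add hexp
  have h2 : (b - 2) ^ 2 / 2 + 0 = (2 - b) ^ 2 / 2 := by ring
  rw [h2] at h1
  exact h1

theorem δSeq_le_one (hp : 2 < p) (k : ℕ) : δSeq p k ≤ 1 := by
  induction k with
  | zero => simp [δSeq]
  | succ k ih => exact (δSeq_aSeq_spec hp k).1.2.le.trans ih

theorem exists_entry (B : BlowupFamily p m τ Λ μ v w) (k : ℕ) :
    ∃ s, BubbleEntry p m Λ μ v w (δSeq p k) (aSeq p k) s := by
  have hp := B.two_lt
  induction k with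
  | zero => exact B.exists_first_entry
  | succ k ih =>
    obtain ⟨s, hs⟩ := ih
    have hδ := δSeq_pos hp k
    have hδ1 := δSeq_le_one hp k
    obtain ⟨ha, ha2⟩ := aSeq_mem hp k
    obtain ⟨c, hc⟩ := B.exists_peak hδ hδ1 ha hs
    obtain ⟨e, he⟩ := B.exists_exit hδ hδ1 ha hc
    exact B.exists_next_entry hδ hδ1 ha ha2 he

theorem exists_center (B : BlowupFamily p m τ Λ μ v w) (k : ℕ) :
    ∃ c, BubblePeak p m Λ μ v w (δSeq p k) (aSeq p k) c :=
  have hp := B.two_lt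
  let ⟨_, hs⟩ := B.exists_entry k
  B.exists_peak (δSeq_pos hp k) (δSeq_le_one hp k) (aSeq_mem hp k).1 hs

/-- At the levels between two bubbles the density is exponentially small. -/
theorem exists_gap (B : BlowupFamily p m τ Λ μ v w) (k : ℕ) {x : ℝ}
    (hx : x ∈ Ioo (δSeq p (k + 1)) (δSeq p k)) :
    ∃ l < 0, ∀ T : ℕ → ℝ, (∀ᶠ n in atTop, T n < 0 ∧ v n (T n) = x * μ n) →
      Tendsto (fun n => logDensity p m (Λ n) (v n) (T n) / μ n ^ p) atTop (𝓝 l) := by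
  have hp := B.two_lt
  have hδ := δSeq_pos hp k
  have hδ1 := δSeq_le_one hp k
  obtain ⟨ha, ha2⟩ := aSeq_mem hp k
  obtain ⟨c, hc⟩ := B.exists_center k
  obtain ⟨e, he⟩ := B.exists_exit hδ hδ1 ha hc
  have hxneg : ratioFun p (aSeq p k) (x / δSeq p k) < 0 :=
    ratioFun_neg hp ha ha2 ⟨(lt_div_iff₀ hδ).2 hx.1, (div_lt_one hδ).2 hx.2⟩
  exact ⟨_, mul_neg_of_pos_of_neg (Real.rpow_pos_of_pos hδ p) hxneg, fun T hT =>
    (B.tendsto_of_exit hδ ha he ((δSeq_pos hp _).trans hx.1) hx.2 hxneg hT).2⟩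

end BlowupFamily

/-! ### The heights `δ_k` tend to zero. -/

theorem monotoneOn_rpow_sub_taylor {p : ℝ} (hp : 2 < p) :
    MonotoneOn (fun z : ℝ => z ^ p - 1 - p * (z - 1) - p * (p - 1) / 2 * (z - 1) ^ 2) (Ioi 0) := by
  have hd : ∀ z ∈ Ioi (0 : ℝ), HasDerivAt
      (fun z : ℝ => z ^ p - 1 - p * (z - 1) - p * (p - 1) / 2 * (z - 1) ^ 2)
      (p * (z ^ (p - 1) - 1 - (p - 1) * (z - 1))) z := by
    intro z hz
    refine (((((hasDerivAt_id z).rpow_const (p := p) (Or.inl (ne_of_gt hz))).sub_const 1).sub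
      (((hasDerivAt_id z).sub_const 1).const_mul p)).sub
      ((((hasDerivAt_id z).sub_const 1).pow 2).const_mul (p * (p - 1) / 2))).congr_deriv ?_
    simp only [id, Nat.cast_ofNat]
    ring
  refine monotoneOn_of_deriv_nonneg (convex_Ioi 0)
    (fun z hz => (hd z hz).continuousAt.continuousWithinAt)
    (fun z hz => (hd z (interior_subset hz)).differentiableAt.differentiableWithinAt)
    (fun z hz => ?_)
  have hz0 : (0 : ℝ) < z := interior_subset hz
  rw [(hd z hz0).deriv]
  have hb := one_add_mul_self_le_rpow_one_add (s := z - 1) (p := p - 1) (by linarith) (by linarith)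
  rw [add_sub_cancel] at hb
  exact mul_nonneg (by linarith) (by linarith)

/-- The equation for `r` reads `2p(1-r) = (2+a)(1-r^p)`. It turns `a` and its successor, each times
`1 - r^p`, into twice the first-order Taylor remainders of `x^p` between `r` and `1`, based at `1`
and at `r`. For `p > 2` these are at most `p(p-1)/2 (1-r)²` and at least `r^{p-2}` times that. -/
theorem aSeq_succ_ge {p a r : ℝ} (hp : 2 < p) (ha : 0 < a) (hr : r ∈ Ioo (0 : ℝ) 1)
    (hfr : ratioFun p a r = 0) :
    a * r ^ (p - 2) ≤ 2 - r ^ (p - 1) * (2 + a) ∧ a ≤ p * (p - 1) * (1 - r) := by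
  obtain ⟨hr0, hr1⟩ := hr
  have hmono := monotoneOn_rpow_sub_taylor hp
  have h1 := hmono (mem_Ioi.2 hr0) (mem_Ioi.2 (zero_lt_one' ℝ)) hr1.le
  have h2 := hmono (mem_Ioi.2 (zero_lt_one' ℝ))
    (mem_Ioi.2 (one_div_pos.2 hr0)) ((one_le_div hr0).2 hr1.le)
  simp only [Real.one_rpow, sub_self, mul_zero, zero_pow two_ne_zero] at h1 h2
  rw [Real.div_rpow zero_le_one hr0.le, Real.one_rpow] at h2
  have hB : 0 < r ^ (p - 2) := Real.rpow_pos_of_pos hr0 _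
  have hr_q : r ^ (p - 1) = r ^ (p - 2) * r := by
    rw [← Real.rpow_add_one hr0.ne']; congr 1; ring
  have hr_p : r ^ p = r ^ (p - 2) * r ^ 2 := by
    rw [rpow_eq_rpow_sub_one_mul (p := p) hr0, hr_q]; ring
  -- The remainder based at `r` is obtained from the one based at `1`, evaluated at `1 / r`, by
  -- scaling with `r^p`.
  have h3 : p * (p - 1) / 2 * r ^ (p - 2) * (1 - r) ^ 2 ≤
      1 - r ^ p - p * r ^ (p - 1) * (1 - r) := by
    have hpos : 0 < r ^ p := Real.rpow_pos_of_pos hr0 _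
    have h4 := mul_nonneg hpos.le h2
    have h5 : r ^ p * (1 / r ^ p - 1 - p * (1 / r - 1) - p * (p - 1) / 2 * (1 / r - 1) ^ 2)
        = 1 - r ^ p - p * r ^ (p - 1) * (1 - r) - p * (p - 1) / 2 * r ^ (p - 2) * (1 - r) ^ 2 := by
      have h6 : r ^ p * (1 / r ^ p - 1 - p * (1 / r - 1) - p * (p - 1) / 2 * (1 / r - 1) ^ 2)
        = 1 - r ^ p - p * (r ^ p * (1 / r - 1)) - p * (p - 1) / 2 * (r ^ p * (1 / r - 1) ^ 2) := by
        field_simp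
      rw [h6, hr_q, hr_p]
      field_simp
    linarith
  have hrp1 : r ^ p ≤ r := by
    simpa using Real.rpow_le_rpow_of_exponent_ge hr0 hr1.le (by linarith : (1 : ℝ) ≤ p)
  have h6 : 2 * p * (1 - r) = (2 + a) * (1 - r ^ p) := by
    unfold ratioFun at hfr
    have h7 : 2 * p / (2 + a) * (1 - r) = 1 - r ^ p := by linarith
    rw [← h7]
    field_simp
  have h8 : a * (1 - r ^ p) ≤ p * (p - 1) * (1 - r) ^ 2 := by nlinarith
  constructor
  · have h9 : (a * r ^ (p - 2)) * (1 - r ^ p) ≤ (2 - r ^ (p - 1) * (2 + a)) * (1 - r ^ p) := by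
      have h10 : (2 - r ^ (p - 1) * (2 + a)) * (1 - r ^ p)
          = 2 * (1 - r ^ p - p * r ^ (p - 1) * (1 - r)) := by
        linear_combination r ^ (p - 1) * h6
      rw [h10]
      nlinarith [mul_le_mul_of_nonneg_left h8 hB.le]
    exact le_of_mul_le_mul_right h9 (by linarith)
  · have h9 : a * (1 - r) ≤ p * (p - 1) * (1 - r) * (1 - r) := by nlinarith
    exact le_of_mul_le_mul_right h9 (by linarith)

theorem two_mul_δSeq_rpow_le {p : ℝ} (hp : 2 < p) (k : ℕ) : 2 * δSeq p k ^ (p - 2) ≤ aSeq p k := by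
  induction k with
  | zero => simp [δSeq, aSeq]
  | succ k ih =>
    obtain ⟨ha, ha2⟩ := aSeq_mem hp k
    obtain ⟨hr, hfr, -⟩ := ratio_spec hp ha ha2
    have h1 := (aSeq_succ_ge hp ha hr hfr).1
    simp only [δSeq, aSeq]
    rw [Real.mul_rpow hr.1.le (δSeq_pos hp k).le]
    nlinarith [Real.rpow_pos_of_pos hr.1 (p - 2)]

/-- A positive limit `d` would make the ratios tend to `1`. Then `a_k ≤ p(p-1)(1 - ratio)` would
tend to `0`, contradicting `a_k ≥ 2 δ_k^{p-2} ≥ 2 d^{p-2}`. -/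
theorem tendsto_δSeq {p : ℝ} (hp : 2 < p) : Tendsto (δSeq p) atTop (𝓝 0) := by
  have hanti : Antitone (δSeq p) := antitone_nat_of_succ_le fun k => (δSeq_aSeq_spec hp k).1.2.le
  have hlim := tendsto_atTop_ciInf hanti ⟨0, by rintro _ ⟨k, rfl⟩; exact (δSeq_pos hp k).le⟩
  set d := ⨅ k, δSeq p k
  have hd0 : 0 ≤ d := ge_of_tendsto' hlim fun k => (δSeq_pos hp k).le
  rcases hd0.eq_or_lt with hd | hd
  · rwa [← hd] at hlim
  exfalso
  have hr : Tendsto (fun k => ratio p (aSeq p k)) atTop (𝓝 1) := by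
    have h1 := ((tendsto_add_atTop_iff_nat 1).2 hlim).div hlim hd.ne'
    rw [div_self hd.ne'] at h1
    refine h1.congr fun k => ?_
    have := δSeq_pos hp k
    simp only [Pi.div_apply, δSeq]
    field_simp
  have h2 : Tendsto (fun k => p * (p - 1) * (1 - ratio p (aSeq p k))) atTop (𝓝 0) := by
    simpa using (hr.const_sub 1).const_mul (p * (p - 1))
  have h3 : Tendsto (fun k => 2 * δSeq p k ^ (p - 2)) atTop (𝓝 (2 * d ^ (p - 2))) :=
    (hlim.rpow_const (Or.inl hd.ne')).const_mul 2
  have h4 := le_of_tendsto_of_tendsto' h3 h2 fun k => by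
    obtain ⟨ha, ha2⟩ := aSeq_mem hp k
    obtain ⟨hr, hfr, -⟩ := ratio_spec hp ha ha2
    exact (two_mul_δSeq_rpow_le hp k).trans (aSeq_succ_ge hp ha hr hfr).2
  linarith [Real.rpow_pos_of_pos hd (p - 2)]

/-! ### From radial solutions to profiles in logarithmic variables. -/

theorem exp_logDensity_eq {p m c₀ τ₀ lam : ℝ} {h : ℝ → ℝ} (hp : 2 < p)
    (hH : PowerExpTail h p c₀ τ₀ m) (hlam : 0 < lam) {v : ℝ → ℝ} {t : ℝ} (hv : τ₀ ≤ v t) :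
    Real.exp (logDensity p m (p * lam * c₀) v t)
      = p * lam * Real.exp t ^ 2 * v t ^ (p - 1) * nonlin h p (v t) := by
  have hv0 := hH.τ₀_pos.trans_le hv
  have hc := hH.c₀_pos
  rw [hH.tail _ hv]
  unfold logDensity
  have h1 : Real.exp ((m + p - 1) * Real.log (v t)) = v t ^ m * v t ^ (p - 1) := by
    rw [mul_comm, ← Real.rpow_def_of_pos hv0, ← Real.rpow_add hv0]; congr 1; ring
  rw [Real.exp_add, Real.exp_add, Real.exp_add, Real.exp_log (by positivity), h1, two_mul,
    Real.exp_add]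
  ring

/-- A radial solution in the variable `t = log r`. -/
theorem IsRadialSolution.emdenProfile {p m c₀ τ₀ lam μ : ℝ} {h u : ℝ → ℝ} (hp : 2 < p)
    (hh : AdmissibleFactor h) (hH : PowerExpTail h p c₀ τ₀ m)
    (hu : IsRadialSolution (nonlin h p) lam μ u) :
    EmdenProfile p m τ₀ (p * lam * c₀) μ (fun t => u (Real.exp t))
      (fun t => deriv u (Real.exp t) * Real.exp t) := by
  have hmem : ∀ t < 0, Real.exp t ∈ Ioo (0 : ℝ) 1 := fun t ht =>
    ⟨Real.exp_pos t, by rwa [Real.exp_lt_one_iff]⟩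
  have hpos : ∀ t < 0, 0 < u (Real.exp t) := fun t ht => hu.pos _ (hmem t ht)
  have hv : ∀ t < 0, HasDerivAt (fun t => u (Real.exp t)) (deriv u (Real.exp t) * Real.exp t) t := by
    intro t ht
    have h1 : DifferentiableAt ℝ u (Real.exp t) :=
      ((hu.contDiffOn.differentiableOn two_ne_zero) _ (hmem t ht)).differentiableAt
        (isOpen_Ioo.mem_nhds (hmem t ht))
    exact h1.hasDerivAt.comp t (Real.hasDerivAt_exp t)
  have hu1 : ContDiffOn ℝ 1 (deriv u) (Ioo 0 1) := hu.contDiffOn.deriv_of_isOpen isOpen_Ioo (by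
    norm_num)
  have hw : ∀ t < 0, HasDerivAt (fun t => deriv u (Real.exp t) * Real.exp t)
      (-(lam * Real.exp t ^ 2 * nonlin h p (u (Real.exp t)))) t := by
    intro t ht
    have h1 : DifferentiableAt ℝ (deriv u) (Real.exp t) :=
      ((hu1.differentiableOn one_ne_zero) _ (hmem t ht)).differentiableAt
        (isOpen_Ioo.mem_nhds (hmem t ht))
    refine ((h1.hasDerivAt.comp t (Real.hasDerivAt_exp t)).mul
      (Real.hasDerivAt_exp t)).congr_deriv ?_
    have h2 := hu.ode _ (hmem t ht)
    have he := Real.exp_pos t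
    simp only [Function.comp]
    have h3 : deriv (deriv u) (Real.exp t) * Real.exp t * Real.exp t
        + deriv u (Real.exp t) * Real.exp t
        = -(-(deriv (deriv u) (Real.exp t)) - 1 / Real.exp t * deriv u (Real.exp t))
          * Real.exp t ^ 2 := by
      field_simp
      ring
    rw [h3, h2]
    ring
  have hanti : AntitoneOn (fun t => deriv u (Real.exp t) * Real.exp t) (Iio 0) := by
    refine antitoneOn_of_deriv_nonpos (convex_Iio 0)
      (fun t ht => (hw t ht).continuousAt.continuousWithinAt)
      (fun t ht => (hw t (interior_subset (s := Iio 0) ht)).differentiableAt.differentiableWithinAt)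
      (fun t ht => ?_)
    have ht' : t < 0 := interior_subset (s := Iio 0) ht
    rw [(hw t ht').deriv]
    have h1 : 0 ≤ nonlin h p (u (Real.exp t)) :=
      mul_nonneg (hh.nonneg _ (hpos t ht').le) (Real.exp_pos _).le
    have := hu.lam_pos
    rw [neg_nonpos]
    positivity
  have hbot : Tendsto (fun t => u (Real.exp t)) atBot (𝓝 μ) := by
    have h1 : Tendsto u (𝓝[Icc 0 1] 0) (𝓝 (u 0)) :=
      hu.continuousOn 0 (left_mem_Icc.2 zero_le_one)
    rw [hu.at_zero] at h1
    refine h1.comp (tendsto_nhdsWithin_iff.2 ⟨Real.tendsto_exp_atBot, ?_⟩)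
    filter_upwards [eventually_lt_atBot (0 : ℝ)] with t ht
    exact Ioo_subset_Icc_self (hmem t ht)
  -- By concavity, a positive slope `W` at `t` would persist backwards and bring `v` down to `0` or
  -- below at time `t - v(t) / W`.
  have hnonpos : ∀ t < 0, deriv u (Real.exp t) * Real.exp t ≤ 0 := by
    intro t ht
    by_contra! hcon
    set W := deriv u (Real.exp t) * Real.exp t
    have hvt := hpos t ht
    have hs : t - u (Real.exp t) / W ≤ t := by
      have : 0 < u (Real.exp t) / W := by positivity
      linarith
    have h1 := mul_sub_le_of_hasDerivAt (C := W) hs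
      (fun r hr => hv r (lt_of_le_of_lt hr.2 ht))
      (fun r hr => hanti (lt_of_le_of_lt hr.2 ht) ht hr.2)
    rw [sub_sub_cancel, mul_div_cancel₀ _ hcon.ne'] at h1
    linarith [hpos _ (lt_of_le_of_lt hs ht)]
  refine ⟨hpos, hv, hnonpos, hanti, ?_, hbot, ?_, ?_⟩
  · intro t ht hτ
    refine (hw t ht).congr_deriv ?_
    have := Real.rpow_pos_of_pos (hpos t ht) (p - 1)
    rw [exp_logDensity_eq (v := fun t => u (Real.exp t)) hp hH hu.lam_pos hτ]
    field_simp
  · rw [tendsto_order]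
    constructor
    · intro b hb
      -- A slope bounded above by some `b < 0` would make `v` unbounded at `-∞`.
      obtain ⟨t, ht0, htb⟩ : ∃ t < 0, b < deriv u (Real.exp t) * Real.exp t := by
        by_contra! hcon
        obtain ⟨t, ht1, ht2, ht3⟩ := ((hbot.eventually_lt_const (lt_add_one μ)).and
          ((eventually_lt_atBot (-1 : ℝ)).and
            (eventually_lt_atBot (-1 - (μ + 1) / (-b))))).exists
        have h1 := mul_sub_le_of_hasDerivAt (C := -b) ht2.le
          (fun r hr => (hv r (by linarith [hr.2])).neg)
          (fun r hr => neg_le_neg (hcon r (by linarith [hr.2])))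
        simp only [Pi.neg_apply] at h1
        have h2 : (μ + 1) / (-b) < -1 - t := by linarith
        rw [div_lt_iff₀ (by linarith)] at h2
        linarith [hpos (-1) (by norm_num)]
      filter_upwards [eventually_le_atBot t] with s hs
      exact htb.trans_le (hanti (lt_of_le_of_lt hs ht0) ht0 hs)
    · intro b hb
      filter_upwards [eventually_lt_atBot (0 : ℝ)] with s hs
      exact (hnonpos s hs).trans_lt hb
  · have h1 : Tendsto u (𝓝[Icc 0 1] 1) (𝓝 (u 1)) :=
      hu.continuousOn 1 (right_mem_Icc.2 zero_le_one)
    rw [hu.at_one] at h1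
    have h2 : Tendsto Real.exp (𝓝[<] 0) (𝓝 1) := by
      have := Real.continuous_exp.tendsto 0
      rw [Real.exp_zero] at this
      exact this.mono_left nhdsWithin_le_nhds
    refine h1.comp (tendsto_nhdsWithin_iff.2 ⟨h2, ?_⟩)
    filter_upwards [self_mem_nhdsWithin] with t ht
    exact Ioo_subset_Icc_self (hmem t ht)

/-! ### Position of the solution relative to the singular curves. -/

theorem log_one_div_exp (t : ℝ) : Real.log (1 / Real.exp t) = -t := by
  rw [one_div, ← Real.exp_neg, Real.log_exp]

namespace BlowupFamily

variable {p m τ : ℝ} {Λ μ : ℕ → ℝ} {v w : ℕ → ℝ → ℝ} {δ a : ℝ}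

theorem tendsto_log_level_div (B : BlowupFamily p m τ Λ μ v w) (hδ : 0 < δ) {s : ℕ → ℝ}
    (h0 : ∀ᶠ n in atTop, s n < 0) (hs : Tendsto (fun n => v n (s n) / μ n) atTop (𝓝 δ)) :
    Tendsto (fun n => Real.log (v n (s n)) / μ n ^ p) atTop (𝓝 0) := by
  have hp : 0 < p := by linarith [B.two_lt]
  have h1 := ((hs.log hδ.ne').mul (B.tendsto_const_div_rpow 1)).add
    ((isLittleO_log_rpow_atTop hp).tendsto_div_nhds_zero.comp B.tendsto_top)
  rw [mul_zero, add_zero] at h1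
  refine h1.congr' ?_
  filter_upwards [h0] with n hn
  have hμ := B.top_pos n
  rw [Real.log_div ((B.profile n).pos _ hn).ne' hμ.ne', Function.comp]
  ring

/-- If `Λ` were exponentially small in `μ^p`, no bubble could form at low heights: at a center `φ`
is bounded and `t < 0`, so `log Λ ≥ -δ_k^p μ^p - o(μ^p)`. This holds for every `k`, and `δ_k → 0`.
-/
theorem tendsto_log_param (B : BlowupFamily p m τ Λ μ v w) (hΛ0 : ∀ n, 0 < Λ n) {C : ℝ}
    (hC : ∀ᶠ n in atTop, Λ n ≤ C) :
    Tendsto (fun n => Real.log (Λ n) / μ n ^ p) atTop (𝓝 0) := by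
  have hp := B.two_lt
  have hp0 : 0 < p := by linarith
  rw [tendsto_order]
  constructor
  · intro b hb
    have h1 : Tendsto (fun k => -(δSeq p k ^ p)) atTop (𝓝 0) := by
      simpa [Real.zero_rpow hp0.ne'] using
        ((tendsto_δSeq hp).rpow_const (p := p) (Or.inr hp0.le)).neg
    obtain ⟨k, hk⟩ := (h1.eventually_const_lt hb).exists
    obtain ⟨c, hc⟩ := B.exists_center k
    have hδ := δSeq_pos hp k
    have ha := (aSeq_mem hp k).1
    have h2 := (((hc.density.log (by positivity)).mul (B.tendsto_const_div_rpow 1)).sub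
      ((B.tendsto_log_level_div hδ hc.neg hc.level).const_mul (m + p - 1))).sub
      (B.tendsto_level_rpow hc.neg hc.level)
    rw [mul_zero, mul_zero, sub_zero, zero_sub] at h2
    filter_upwards [h2.eventually_const_lt hk, hc.neg] with n h3 h4
    refine h3.trans_le ?_
    have hμp := Real.rpow_pos_of_pos (B.top_pos n) p
    rw [Real.log_exp, mul_one_div, ← mul_div_assoc, ← sub_div, ← sub_div]
    gcongr
    unfold logDensity
    linarith
  · intro b hb
    filter_upwards [(B.tendsto_const_div_rpow (Real.log C)).eventually_lt_const hb, hC]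
      with n h1 h2
    refine lt_of_le_of_lt ?_ h1
    have hμp := Real.rpow_pos_of_pos (B.top_pos n) p
    have := Real.log_le_log (hΛ0 n) h2
    gcongr

/-- The definition of `φ` is solved for `-2t`; the logarithms of `Λ` and of the height are `o(μ^p)`.
-/
theorem tendsto_time (B : BlowupFamily p m τ Λ μ v w)
    (hΛ : Tendsto (fun n => Real.log (Λ n) / μ n ^ p) atTop (𝓝 0)) (hδ : 0 < δ) {s : ℕ → ℝ} {l : ℝ}
    (h0 : ∀ᶠ n in atTop, s n < 0) (hs : Tendsto (fun n => v n (s n) / μ n) atTop (𝓝 δ))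
    (hφ : Tendsto (fun n => logDensity p m (Λ n) (v n) (s n) / μ n ^ p) atTop (𝓝 l)) :
    Tendsto (fun n => -(2 * s n) / μ n ^ p) atTop (𝓝 (δ ^ p - l)) := by
  have h1 := ((((B.tendsto_log_level_div hδ h0 hs).const_mul (m + p - 1)).add
    (B.tendsto_level_rpow h0 hs)).add hΛ).sub hφ
  rw [mul_zero, zero_add, add_zero] at h1
  refine h1.congr fun n => ?_
  unfold logDensity
  ring

theorem time_tendsto_atBot (B : BlowupFamily p m τ Λ μ v w) {s : ℕ → ℝ} {l : ℝ} (hl : 0 < l)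
    (h : Tendsto (fun n => -(2 * s n) / μ n ^ p) atTop (𝓝 l)) : Tendsto s atTop atBot := by
  refine B.tendsto_atBot_of_div_rpow (l := -(l / 2)) (by linarith) ((h.div_const 2).neg.congr fun n => ?_)
  ring

theorem eventually_lt_Ucurve (B : BlowupFamily p m τ Λ μ v w)
    (hΛ : Tendsto (fun n => Real.log (Λ n) / μ n ^ p) atTop (𝓝 0)) (hδ : 0 < δ) {s : ℕ → ℝ} {l : ℝ}
    (h0 : ∀ᶠ n in atTop, s n < 0) (hs : Tendsto (fun n => v n (s n) / μ n) atTop (𝓝 δ))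
    (hl : l < 0)
    (hφ : Tendsto (fun n => logDensity p m (Λ n) (v n) (s n) / μ n ^ p) atTop (𝓝 l)) :
    Tendsto s atTop atBot ∧
    ∃ ε ∈ Ioo (0 : ℝ) 2, ∀ᶠ n in atTop, v n (s n) < Ucurve p (2 - ε) (Real.exp (s n)) := by
  have hp0 : 0 < p := by linarith [B.two_lt]
  have hδp := Real.rpow_pos_of_pos hδ p
  have htime := B.tendsto_time hΛ hδ h0 hs hφ
  have hpos : 0 < δ ^ p - l := by linarith
  -- In units of `μ^p`, `v^p` tends to `δ^p`, while `U_{2-ε}^p` tends to `(2-ε)/2 (δ^p - l)`. This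
  -- `ε` makes the latter `δ^p - l/2`, which uses half of the room.
  refine ⟨B.time_tendsto_atBot hpos htime, -l / (δ ^ p - l), ⟨by positivity [neg_pos.2 hl], ?_⟩, ?_⟩
  · rw [div_lt_iff₀ hpos]; linarith
  set ε := -l / (δ ^ p - l) with hε
  have h1 := (htime.const_mul ((2 - ε) / 2)).sub (B.tendsto_level_rpow h0 hs)
  have h2 : 0 < (2 - ε) / 2 * (δ ^ p - l) - δ ^ p := by
    have : ε * (δ ^ p - l) = -l := by rw [hε]; field_simp
    nlinarith
  filter_upwards [h1.eventually_const_lt h2, h0] with n h3 h4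
  have hμp := Real.rpow_pos_of_pos (B.top_pos n) p
  have hv := (B.profile n).pos _ h4
  have h5 : v n (s n) ^ p < (2 - ε) * -s n := by
    rw [← mul_div_assoc, ← sub_div] at h3
    have := (div_pos_iff_of_pos_right hμp).1 h3
    linarith
  unfold Ucurve
  rw [log_one_div_exp]
  calc v n (s n) = (v n (s n) ^ p) ^ (1 / p) := by
        rw [one_div, Real.rpow_rpow_inv hv.le hp0.ne']
    _ < _ := Real.rpow_lt_rpow (by positivity) h5 (by positivity)

/-- With `X = 2 log(1/r)` and `κ = 1 - (1-m)/p`, the definition of `φ` reads `v^p = X - κ log X + (φ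
- log Λ + κ log(X / v^p))`. Since `X / v^p → 1` and `φ → log d`, the bracket exceeds `L` as soon as
`log Λ + L < log d - 1`. -/
theorem eventually_Vcurve_lt (B : BlowupFamily p m τ Λ μ v w)
    (hΛ : Tendsto (fun n => Real.log (Λ n) / μ n ^ p) atTop (𝓝 0)) (hδ : 0 < δ) {s : ℕ → ℝ} {d : ℝ}
    (h0 : ∀ᶠ n in atTop, s n < 0) (hs : Tendsto (fun n => v n (s n) / μ n) atTop (𝓝 δ))
    (hd : 0 < d) (hφ : Tendsto (fun n => Real.exp (logDensity p m (Λ n) (v n) (s n))) atTop (𝓝 d)) :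
    Tendsto s atTop atBot ∧
    ∀ L, (∀ᶠ n in atTop, Real.log (Λ n) + L < Real.log d - 1) →
      ∀ᶠ n in atTop, Vcurve p m L (Real.exp (s n)) < v n (s n) := by
  have hp0 : 0 < p := by linarith [B.two_lt]
  have hδp := Real.rpow_pos_of_pos hδ p
  have hφ' : Tendsto (fun n => logDensity p m (Λ n) (v n) (s n)) atTop (𝓝 (Real.log d)) :=
    (hφ.log hd.ne').congr fun n => Real.log_exp _
  have hφ0 : Tendsto (fun n => logDensity p m (Λ n) (v n) (s n) / μ n ^ p) atTop (𝓝 0) := by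
    have := hφ'.mul (B.tendsto_const_div_rpow 1)
    rw [mul_zero] at this
    refine this.congr fun n => mul_one_div _ _
  have htime := B.tendsto_time hΛ hδ h0 hs hφ0
  rw [sub_zero] at htime
  have hbot := B.time_tendsto_atBot hδp htime
  refine ⟨hbot, fun L hL => ?_⟩
  set κ := 1 - (1 - m) / p with hκ
  have hX : Tendsto (fun n => -(2 * s n)) atTop atTop :=
    tendsto_neg_atBot_atTop.comp (hbot.const_mul_atBot two_pos)
  have h1 : Tendsto (fun n => 1 - κ * (Real.log (-(2 * s n)) / -(2 * s n)) + L / -(2 * s n)) atTop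
      (𝓝 (1 - κ * 0 + 0)) :=
    (((Real.isLittleO_log_id_atTop.tendsto_div_nhds_zero.comp hX).const_mul κ).const_sub 1).add
      (hX.const_div_atTop L)
  have h2 : Tendsto (fun n => logDensity p m (Λ n) (v n) (s n)
      + κ * Real.log (-(2 * s n) / v n (s n) ^ p)) atTop
      (𝓝 (Real.log d + κ * Real.log (δ ^ p / δ ^ p))) := by
    refine hφ'.add (Tendsto.const_mul κ (Tendsto.log ?_ (by positivity)))
    refine (htime.div (B.tendsto_level_rpow h0 hs) hδp.ne').congr fun n => ?_
    exact div_div_div_cancel_right₀ (Real.rpow_pos_of_pos (B.top_pos n) p).ne' _ _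
  rw [div_self hδp.ne', Real.log_one, mul_zero, add_zero] at h2
  filter_upwards [h1.eventually_const_lt (by norm_num : (0 : ℝ) < 1 - κ * 0 + 0),
    h2.eventually_const_lt (sub_one_lt (Real.log d)), h0, hL] with n h3 h4 h5 h6
  have hv := (B.profile n).pos _ h5
  have hvp := Real.rpow_pos_of_pos hv p
  have hXn : 0 < -(2 * s n) := by linarith
  have hXe : 2 * Real.log (1 / Real.exp (s n)) = -(2 * s n) := by rw [log_one_div_exp]; ring
  unfold Vcurve
  rw [hXe]
  set X := -(2 * s n) with hXdef
  have hbase : 0 < X - κ * Real.log X + L := by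
    have := mul_pos h3 hXn
    have h7 : (1 - κ * (Real.log X / X) + L / X) * X = X - κ * Real.log X + L := by
      field_simp
    rwa [h7] at this
  have hlt : X - κ * Real.log X + L < v n (s n) ^ p := by
    have h8 : (m + p - 1) * Real.log (v n (s n)) = κ * Real.log (v n (s n) ^ p) := by
      rw [Real.log_rpow hv, hκ]
      field_simp
      ring
    rw [Real.log_div hXn.ne' hvp.ne'] at h4
    unfold logDensity at h4
    rw [h8] at h4
    linarith
  calc _ < (v n (s n) ^ p) ^ (1 / p) := Real.rpow_lt_rpow hbase.le hlt (by positivity)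
    _ = v n (s n) := by rw [one_div, Real.rpow_rpow_inv hv.le hp0.ne']

end BlowupFamily

/-! ### Crossings with a barrier on both sides of each center. -/

/-- The comparison function `U` lies between the singular curves. -/
structure IsBarrier (p m : ℝ) (Λ : ℕ → ℝ) (R₀ : ℝ) (U : ℝ → ℝ) : Prop where
  pos : 0 < R₀
  continuousOn : ContinuousOn U (Ioo 0 R₀)
  lower : ∀ ε ∈ Ioo (0 : ℝ) 2, ∃ r₀ > 0, ∀ r ∈ Ioo 0 r₀, Ucurve p (2 - ε) r ≤ U r
  upper : ∀ A : ℝ, ∃ L, ∃ r₀ > 0, (∀ᶠ n in atTop, Real.log (Λ n) + L < A) ∧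
    ∀ r ∈ Ioo 0 r₀, U r ≤ Vcurve p m L r

theorem eventually_exp_lt {s : ℕ → ℝ} (hs : Tendsto s atTop atBot) {r : ℝ} (hr : 0 < r) :
    ∀ᶠ n in atTop, Real.exp (s n) ∈ Ioo 0 r := by
  filter_upwards [(Real.tendsto_exp_atBot.comp hs).eventually_lt_const hr] with n hn
  exact ⟨Real.exp_pos _, hn⟩

namespace BlowupFamily

variable {p m τ R₀ : ℝ} {Λ μ : ℕ → ℝ} {v w : ℕ → ℝ → ℝ} {U : ℝ → ℝ}

theorem exists_level_below (B : BlowupFamily p m τ Λ μ v w)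
    (hΛ : Tendsto (fun n => Real.log (Λ n) / μ n ^ p) atTop (𝓝 0)) (hU : IsBarrier p m Λ R₀ U)
    (k : ℕ) {x : ℝ} (hx : x ∈ Ioo (δSeq p (k + 1)) (δSeq p k)) :
    ∃ T : ℕ → ℝ, (∀ n, T n < 0 ∧ v n (T n) = x * μ n) ∧
      ∀ᶠ n in atTop, Real.exp (T n) < R₀ ∧ v n (T n) < U (Real.exp (T n)) := by
  have hp := B.two_lt
  have hx0 : 0 < x := (δSeq_pos hp _).trans hx.1
  have hx1 : x < 1 := hx.2.trans_le (δSeq_le_one hp k)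
  choose T hT hvT using fun n => (B.profile n).exists_level (x := x * μ n)
    (mul_pos hx0 (B.top_pos n)) (by nlinarith [B.top_pos n])
  obtain ⟨l, hl, hgap⟩ := B.exists_gap k hx
  have hTlev : Tendsto (fun n => v n (T n) / μ n) atTop (𝓝 x) := by
    refine tendsto_const_nhds.congr fun n => ?_
    rw [hvT n, mul_div_cancel_right₀ _ (B.top_pos n).ne']
  obtain ⟨hbot, ε, hε, hlt⟩ := B.eventually_lt_Ucurve hΛ hx0 (Eventually.of_forall hT) hTlev hl
    (hgap T (Eventually.of_forall fun n => ⟨hT n, hvT n⟩))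
  obtain ⟨r₀, hr₀, hlow⟩ := hU.lower ε hε
  refine ⟨T, fun n => ⟨hT n, hvT n⟩, ?_⟩
  filter_upwards [hlt, eventually_exp_lt hbot hr₀, eventually_exp_lt hbot hU.pos] with n h1 h2 h3
  exact ⟨h3.2, h1.trans_le (hlow _ h2)⟩

theorem exists_crossing (B : BlowupFamily p m τ Λ μ v w) (hU : IsBarrier p m Λ R₀ U) {n : ℕ}
    {s t : ℝ} (hst : s ≤ t) (ht : t < 0) (htR : Real.exp t < R₀)
    (h : (v n s < U (Real.exp s) ∧ U (Real.exp t) < v n t) ∨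
      (U (Real.exp s) < v n s ∧ v n t < U (Real.exp t))) :
    ∃ r ∈ Ioo s t, v n r = U (Real.exp r) := by
  have hc : ContinuousOn (fun r => v n r - U (Real.exp r)) (Icc s t) := by
    refine ((B.profile n).continuousOn.mono fun r hr => lt_of_le_of_lt hr.2 ht).sub
      (hU.continuousOn.comp Real.continuous_exp.continuousOn fun r hr => ⟨Real.exp_pos r, ?_⟩)
    exact lt_of_le_of_lt (Real.exp_le_exp.2 hr.2) htR
  rcases h with ⟨h1, h2⟩ | ⟨h1, h2⟩
  · obtain ⟨r, hr, hr0⟩ := intermediate_value_Ioo hst hc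
      (show (0 : ℝ) ∈ _ from ⟨sub_neg.2 h1, sub_pos.2 h2⟩)
    exact ⟨r, hr, sub_eq_zero.1 hr0⟩
  · obtain ⟨r, hr, hr0⟩ := intermediate_value_Ioo' hst hc
      (show (0 : ℝ) ∈ _ from ⟨sub_neg.2 h2, sub_pos.2 h1⟩)
    exact ⟨r, hr, sub_eq_zero.1 hr0⟩

theorem eventually_above (B : BlowupFamily p m τ Λ μ v w)
    (hΛ : Tendsto (fun n => Real.log (Λ n) / μ n ^ p) atTop (𝓝 0)) (hU : IsBarrier p m Λ R₀ U)
    (k : ℕ) {s : ℕ → ℝ} (h0 : ∀ᶠ n in atTop, s n < 0)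
    (hs : Tendsto (fun n => v n (s n) / μ n) atTop (𝓝 (δSeq p k)))
    (hφ : Tendsto (fun n => Real.exp (logDensity p m (Λ n) (v n) (s n))) atTop
      (𝓝 (aSeq p k ^ 2 / 2))) :
    ∀ᶠ n in atTop, Real.exp (s n) < R₀ ∧ U (Real.exp (s n)) < v n (s n) := by
  have hp := B.two_lt
  have ha := (aSeq_mem hp k).1
  obtain ⟨hbot, hV⟩ := B.eventually_Vcurve_lt hΛ (δSeq_pos hp k) h0 hs (by positivity) hφ
  obtain ⟨L, r₀, hr₀, hL, hup⟩ := hU.upper (Real.log (aSeq p k ^ 2 / 2) - 1)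
  filter_upwards [hV L hL, eventually_exp_lt hbot hr₀, eventually_exp_lt hbot hU.pos]
    with n h1 h2 h3
  exact ⟨h3.2, (hup _ h2).trans_lt h1⟩

theorem tendsto_level_of_abs {δ : ℝ} {s : ℕ → ℝ}
    (h : Tendsto (fun n => |v n (s n) / μ n - δ|) atTop (𝓝 0)) :
    Tendsto (fun n => v n (s n) / μ n) atTop (𝓝 δ) :=
  tendsto_sub_nhds_zero_iff.1 ((tendsto_zero_iff_abs_tendsto_zero _).2 h)

/-- At the center `v > U`; to the left, in the preceding gap or near `r = 0` for the first bubble,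
`v < U`. Choosing the gap level close to `δ_k` pins the height of the crossing. -/
theorem exists_crossing_left (B : BlowupFamily p m τ Λ μ v w)
    (hΛ : Tendsto (fun n => Real.log (Λ n) / μ n ^ p) atTop (𝓝 0)) (hU : IsBarrier p m Λ R₀ U)
    (k : ℕ) {s : ℕ → ℝ} (h0 : ∀ᶠ n in atTop, s n < 0)
    (hs : Tendsto (fun n => v n (s n) / μ n) atTop (𝓝 (δSeq p k)))
    (hφ : Tendsto (fun n => Real.exp (logDensity p m (Λ n) (v n) (s n))) atTop
      (𝓝 (aSeq p k ^ 2 / 2))) :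
    ∃ t : ℕ → ℝ, (∀ᶠ n in atTop, t n < s n ∧ v n (t n) = U (Real.exp (t n))) ∧
      Tendsto (fun n => v n (t n) / μ n) atTop (𝓝 (δSeq p k)) := by
  have hp := B.two_lt
  have hp0 : 0 < p := by linarith
  obtain ⟨t, ht, hlim⟩ := exists_seq_tendsto_zero
    (S := fun n t => t < s n ∧ v n t = U (Real.exp t))
    (F := fun n t => |v n t / μ n - δSeq p k|) (fun n t => abs_nonneg _) <| by
    intro η hη
    cases k with
    | zero =>
      obtain ⟨r₀, hr₀, hlow⟩ := hU.lower 1 (by norm_num)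
      filter_upwards [h0, B.eventually_above hΛ hU 0 h0 hs hφ,
        hs.eventually_const_lt (sub_lt_self _ hη)] with n h1 h2 h3
      have hμ := B.top_pos n
      have hμp := Real.rpow_pos_of_pos hμ p
      have P := B.profile n
      -- No gap precedes the first bubble. The time `T` lies left of the center, in the range of the
      -- lower bound, and below `-μ^p`, where the curve with `2 - ε = 1` exceeds `μ ≥ v`.
      set T := min (min (s n) (Real.log r₀)) (-(μ n ^ p)) - 1 with hT
      have hTs : T < s n := by
        have := (min_le_left (min (s n) (Real.log r₀)) (-(μ n ^ p))).trans (min_le_left _ _)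
        linarith
      have hTr : T < Real.log r₀ := by
        have := (min_le_left (min (s n) (Real.log r₀)) (-(μ n ^ p))).trans (min_le_right _ _)
        linarith
      have hTμ : μ n ^ p < -T := by
        have := min_le_right (min (s n) (Real.log r₀)) (-(μ n ^ p))
        linarith
      have hTU : v n T < U (Real.exp T) := by
        refine lt_of_lt_of_le ?_
          (hlow _ ⟨Real.exp_pos T, (Real.lt_log_iff_exp_lt hr₀).1 hTr⟩)
        refine (P.le_top (hTs.trans h1)).trans_lt ?_
        unfold Ucurve
        rw [log_one_div_exp]
        calc μ n = (μ n ^ p) ^ (1 / p) := by rw [one_div, Real.rpow_rpow_inv hμ.le hp0.ne']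
          _ < _ := Real.rpow_lt_rpow hμp.le (by linarith) (by positivity)
      obtain ⟨r, hr, hr0⟩ := B.exists_crossing hU hTs.le h1 h2.1 (Or.inl ⟨hTU, h2.2⟩)
      refine ⟨r, ⟨hr.2, hr0⟩, ?_⟩
      have h4 : v n (s n) / μ n ≤ v n r / μ n := by
        have := P.le_of_le hr.2.le h1
        gcongr
      have h5 : v n r / μ n ≤ 1 := (div_le_one hμ).2 (P.le_top (hr.2.trans h1))
      simp only [δSeq] at h3 ⊢
      rw [abs_lt]
      constructor <;> linarith
    | succ k =>
      obtain ⟨x, hx1, hx2⟩ := exists_between (lt_min (δSeq_aSeq_spec hp k).1.2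
        (lt_add_of_pos_right (δSeq p (k + 1)) hη))
      obtain ⟨T, hT, hTU⟩ := B.exists_level_below hΛ hU k ⟨hx1, hx2.trans_le (min_le_left _ _)⟩
      filter_upwards [h0, B.eventually_above hΛ hU _ h0 hs hφ,
        hs.eventually_const_lt (sub_lt_self _ hη), hTU, hs.eventually_lt_const hx1]
        with n h1 h2 h3 h4 h5
      have hμ := B.top_pos n
      have P := B.profile n
      rw [div_lt_iff₀ hμ, ← (hT n).2] at h5
      have hTs := P.lt_of_lt (hT n).1 h5
      obtain ⟨r, hr, hr0⟩ := B.exists_crossing hU hTs.le h1 h2.1 (Or.inl ⟨h4.2, h2.2⟩)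
      refine ⟨r, ⟨hr.2, hr0⟩, ?_⟩
      have h6 : v n (s n) / μ n ≤ v n r / μ n := by
        have := P.le_of_le hr.2.le h1
        gcongr
      have h7 : v n r / μ n ≤ x := by
        rw [div_le_iff₀ hμ, ← (hT n).2]
        exact P.le_of_le hr.1.le (hr.2.trans h1)
      have h8 := hx2.trans_le (min_le_right _ _)
      rw [abs_lt]
      constructor <;> linarith
  exact ⟨t, ht, tendsto_level_of_abs hlim⟩

theorem exists_crossing_right (B : BlowupFamily p m τ Λ μ v w)
    (hΛ : Tendsto (fun n => Real.log (Λ n) / μ n ^ p) atTop (𝓝 0)) (hU : IsBarrier p m Λ R₀ U)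
    (k : ℕ) {s : ℕ → ℝ} (h0 : ∀ᶠ n in atTop, s n < 0)
    (hs : Tendsto (fun n => v n (s n) / μ n) atTop (𝓝 (δSeq p k)))
    (hφ : Tendsto (fun n => Real.exp (logDensity p m (Λ n) (v n) (s n))) atTop
      (𝓝 (aSeq p k ^ 2 / 2))) :
    ∃ t : ℕ → ℝ, (∀ᶠ n in atTop, s n < t n ∧ t n < 0 ∧ Real.exp (t n) < R₀ ∧
        v n (t n) = U (Real.exp (t n))) ∧
      Tendsto (fun n => v n (t n) / μ n) atTop (𝓝 (δSeq p k)) := by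
  have hp := B.two_lt
  obtain ⟨t, ht, hlim⟩ := exists_seq_tendsto_zero
    (S := fun n t => s n < t ∧ t < 0 ∧ Real.exp t < R₀ ∧ v n t = U (Real.exp t))
    (F := fun n t => |v n t / μ n - δSeq p k|) (fun n t => abs_nonneg _) <| by
    intro η hη
    obtain ⟨x, hx1, hx2⟩ := exists_between (max_lt (δSeq_aSeq_spec hp k).1.2
      (sub_lt_self (δSeq p k) hη))
    obtain ⟨T, hT, hTU⟩ := B.exists_level_below hΛ hU k ⟨(le_max_left _ _).trans_lt hx1, hx2⟩
    filter_upwards [h0, B.eventually_above hΛ hU _ h0 hs hφ,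
      hs.eventually_lt_const (lt_add_of_pos_right _ hη), hTU, hs.eventually_const_lt hx2]
      with n h1 h2 h3 h4 h5
    have hμ := B.top_pos n
    have P := B.profile n
    rw [lt_div_iff₀ hμ, ← (hT n).2] at h5
    have hsT := P.lt_of_lt h1 h5
    obtain ⟨r, hr, hr0⟩ := B.exists_crossing hU hsT.le (hT n).1 h4.1 (Or.inr ⟨h2.2, h4.2⟩)
    have hr0' := hr.2.trans (hT n).1
    refine ⟨r, ⟨hr.1, hr0', (Real.exp_lt_exp.2 hr.2).trans h4.1, hr0⟩, ?_⟩
    have h6 : v n r / μ n ≤ v n (s n) / μ n := by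
      have := P.le_of_le hr.1.le hr0'
      gcongr
    have h7 : x ≤ v n r / μ n := by
      rw [le_div_iff₀ hμ, ← (hT n).2]
      exact P.le_of_le hr.2.le (hT n).1
    have h8 := (le_max_right _ _).trans_lt hx1
    rw [abs_lt]
    constructor <;> linarith
  exact ⟨t, ht, tendsto_level_of_abs hlim⟩

end BlowupFamily

/-! ### Return to the radial variable and the count of intersections. -/

theorem IsRadialSolution.lt_of_lt {p m c₀ τ₀ lam μ r s : ℝ} {h u : ℝ → ℝ} (hp : 2 < p)
    (hh : AdmissibleFactor h) (hH : PowerExpTail h p c₀ τ₀ m)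
    (hu : IsRadialSolution (nonlin h p) lam μ u) (hr : r ∈ Ioo (0 : ℝ) 1) (hs : s ∈ Ioo (0 : ℝ) 1)
    (hlt : u s < u r) : r < s := by
  have h1 := (hu.emdenProfile hp hh hH).lt_of_lt (s := Real.log r) (t := Real.log s)
    (Real.log_neg hr.1 hr.2) (by simpa only [Real.exp_log hr.1, Real.exp_log hs.1] using hlt)
  exact (Real.log_lt_log_iff hr.1 hs.1).1 h1

/-- A family of radial solutions blowing up, together with a barrier. -/
structure BarrierProblem (p c₀ τ₀ m : ℝ) (h : ℝ → ℝ) (lam μ : ℕ → ℝ) (u : ℕ → ℝ → ℝ)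
    (R₀ : ℝ) (U : ℝ → ℝ) : Prop where
  two_lt : 2 < p
  factor : AdmissibleFactor h
  tail : PowerExpTail h p c₀ τ₀ m
  sol : ∀ n, IsRadialSolution (nonlin h p) (lam n) (μ n) (u n)
  tendsto_top : Tendsto μ atTop atTop
  bounded : ∃ C, ∀ᶠ n in atTop, p * lam n * c₀ ≤ C
  barrier : IsBarrier p m (fun n => p * lam n * c₀) R₀ U

/-- Intersections of `u n` with the barrier on both sides of a bubble of height `δ`. -/
structure CrossingPair (μ : ℕ → ℝ) (u : ℕ → ℝ → ℝ) (R₀ : ℝ) (U : ℝ → ℝ) (δ : ℝ)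
    (rm rp : ℕ → ℝ) : Prop where
  mem : ∀ n, rm n ∈ Ioo (0 : ℝ) 1 ∧ rp n ∈ Ioo (0 : ℝ) 1 ∧ rm n < rp n
  level_left : Tendsto (fun n => u n (rm n) / μ n) atTop (𝓝 δ)
  level_right : Tendsto (fun n => u n (rp n) / μ n) atTop (𝓝 δ)
  zero : ∀ᶠ n in atTop, rm n < R₀ ∧ rp n < R₀ ∧ u n (rm n) = U (rm n) ∧ u n (rp n) = U (rp n)

namespace BarrierProblem

variable {p c₀ τ₀ m R₀ : ℝ} {h U : ℝ → ℝ} {lam μ : ℕ → ℝ} {u : ℕ → ℝ → ℝ}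

theorem family (Q : BarrierProblem p c₀ τ₀ m h lam μ u R₀ U) :
    BlowupFamily p m τ₀ (fun n => p * lam n * c₀) μ (fun n t => u n (Real.exp t))
      (fun n t => deriv (u n) (Real.exp t) * Real.exp t) :=
  ⟨Q.two_lt, fun n => (Q.sol n).emdenProfile Q.two_lt Q.factor Q.tail, Q.tendsto_top⟩

theorem tendsto_log_param (Q : BarrierProblem p c₀ τ₀ m h lam μ u R₀ U) :
    Tendsto (fun n => Real.log (p * lam n * c₀) / μ n ^ p) atTop (𝓝 0) := by
  obtain ⟨C, hC⟩ := Q.bounded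
  refine Q.family.tendsto_log_param (fun n => ?_) hC
  have := (Q.sol n).lam_pos
  have := Q.tail.c₀_pos
  have := Q.two_lt
  positivity

theorem eventually_exp_eq (Q : BarrierProblem p c₀ τ₀ m h lam μ u R₀ U) {s : ℕ → ℝ} {δ : ℝ}
    (hδ : 0 < δ) (h0 : ∀ᶠ n in atTop, s n < 0)
    (hs : Tendsto (fun n => u n (Real.exp (s n)) / μ n) atTop (𝓝 δ)) :
    ∀ᶠ n in atTop, Real.exp (logDensity p m (p * lam n * c₀) (fun t => u n (Real.exp t)) (s n)) =
      p * lam n * Real.exp (s n) ^ 2 * u n (Real.exp (s n)) ^ (p - 1)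
        * nonlin h p (u n (Real.exp (s n))) := by
  filter_upwards [Q.family.eventually_level_le hs (half_lt_self hδ), h0,
    Q.family.eventually_le_mul_rpow (half_pos hδ) one_pos 0] with n h1 h2 h3
  exact exp_logDensity_eq (v := fun t => u n (Real.exp t)) Q.two_lt Q.tail (Q.sol n).lam_pos
    (h3 _ h2 h1.le).1

theorem exists_isBubbleCenter (Q : BarrierProblem p c₀ τ₀ m h lam μ u R₀ U) (k : ℕ) :
    ∃ rc, IsBubbleCenter (nonlin h p) p lam μ u k rc := by
  obtain ⟨c, hc⟩ := Q.family.exists_center k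
  -- Centers must lie in `(0,1)` for every `n`; the value `1 / 2` fills the finitely many
  -- exceptional indices.
  have heq : ∀ᶠ n in atTop, (if c n < 0 then Real.exp (c n) else 1 / 2) = Real.exp (c n) :=
    hc.neg.mono fun n hn => if_pos hn
  refine ⟨fun n => if c n < 0 then Real.exp (c n) else 1 / 2, fun n => ?_, ?_, ?_⟩
  · split_ifs with hn
    · exact ⟨Real.exp_pos _, Real.exp_lt_one_iff.2 hn⟩
    · norm_num
  · refine hc.level.congr' ?_
    filter_upwards [heq] with n hn
    rw [hn]
  · refine hc.density.congr' ?_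
    filter_upwards [heq, Q.eventually_exp_eq (δSeq_pos Q.two_lt k) hc.neg hc.level] with n hn hn2
    rw [hn, hn2]

theorem exists_crossingPair (Q : BarrierProblem p c₀ τ₀ m h lam μ u R₀ U) {k : ℕ} {rc : ℕ → ℝ}
    (hrc : IsBubbleCenter (nonlin h p) p lam μ u k rc) :
    ∃ rm rp, CrossingPair μ u R₀ U (δSeq p k) rm rp ∧ ∀ n, rm n < rc n ∧ rc n < rp n := by
  have hexp : ∀ n, Real.exp (Real.log (rc n)) = rc n := fun n => Real.exp_log (hrc.mem n).1
  have h0 : ∀ᶠ n in atTop, Real.log (rc n) < 0 :=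
    Eventually.of_forall fun n => Real.log_neg (hrc.mem n).1 (hrc.mem n).2
  have hlev : Tendsto (fun n => u n (Real.exp (Real.log (rc n))) / μ n) atTop (𝓝 (δSeq p k)) := by
    simpa only [hexp] using hrc.level
  have hdens : Tendsto (fun n => Real.exp (logDensity p m (p * lam n * c₀)
      (fun t => u n (Real.exp t)) (Real.log (rc n)))) atTop (𝓝 (aSeq p k ^ 2 / 2)) := by
    refine hrc.density.congr' ?_
    filter_upwards [Q.eventually_exp_eq (δSeq_pos Q.two_lt k) h0 hlev] with n hn
    rw [hn, hexp]
  obtain ⟨a, ha, hal⟩ := Q.family.exists_crossing_left Q.tendsto_log_param Q.barrier k h0 hlev hdens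
  obtain ⟨b, hb, hbl⟩ := Q.family.exists_crossing_right Q.tendsto_log_param Q.barrier k h0 hlev hdens
  -- The default values `rc n / 2` and `(rc n + 1) / 2` keep the ordering around `rc n` inside
  -- `(0,1)` at indices where no crossing has been found.
  set rm : ℕ → ℝ := fun n => if Real.exp (a n) < rc n then Real.exp (a n) else rc n / 2
  set rp : ℕ → ℝ := fun n => if rc n < Real.exp (b n) ∧ Real.exp (b n) < 1 then Real.exp (b n)
    else (rc n + 1) / 2
  have heqa : ∀ᶠ n in atTop, rm n = Real.exp (a n) := by
    filter_upwards [ha] with n hn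
    exact if_pos (by rw [← hexp n]; exact Real.exp_lt_exp.2 hn.1)
  have heqb : ∀ᶠ n in atTop, rp n = Real.exp (b n) := by
    filter_upwards [hb] with n hn
    exact if_pos ⟨by rw [← hexp n]; exact Real.exp_lt_exp.2 hn.1, Real.exp_lt_one_iff.2 hn.2.1⟩
  have hm : ∀ n, 0 < rm n ∧ rm n < rc n := fun n => by
    have := hrc.mem n
    simp only [rm]
    split_ifs with hn
    · exact ⟨Real.exp_pos _, hn⟩
    · constructor <;> linarith [this.1]
  have hp : ∀ n, rc n < rp n ∧ rp n < 1 := fun n => by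
    have := hrc.mem n
    simp only [rp]
    split_ifs with hn
    · exact hn
    · constructor <;> linarith [this.2]
  refine ⟨rm, rp, ⟨fun n => ?_, ?_, ?_, ?_⟩, fun n => ⟨(hm n).2, (hp n).1⟩⟩
  · have h1 := hm n
    have h2 := hp n
    have h3 := hrc.mem n
    exact ⟨⟨h1.1, h1.2.trans h3.2⟩, ⟨h3.1.trans h2.1, h2.2⟩, h1.2.trans h2.1⟩
  · refine hal.congr' ?_
    filter_upwards [heqa] with n hn
    rw [hn]
  · refine hbl.congr' ?_
    filter_upwards [heqb] with n hn
    rw [hn]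
  · filter_upwards [heqa, heqb, ha, hb] with n h1 h2 h3 h4
    rw [h1, h2]
    exact ⟨(Real.exp_lt_exp.2 (h3.1.trans h4.1)).trans h4.2.2.1, h4.2.2.1, h3.2, h4.2.2.2⟩

theorem eventually_lt_of_level_lt (Q : BarrierProblem p c₀ τ₀ m h lam μ u R₀ U) {r s : ℕ → ℝ}
    {δ δ' : ℝ} (hr : ∀ n, r n ∈ Ioo (0 : ℝ) 1) (hs : ∀ n, s n ∈ Ioo (0 : ℝ) 1)
    (hrl : Tendsto (fun n => u n (r n) / μ n) atTop (𝓝 δ))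
    (hsl : Tendsto (fun n => u n (s n) / μ n) atTop (𝓝 δ')) (hδ : δ' < δ) :
    ∀ᶠ n in atTop, r n < s n := by
  filter_upwards [hsl.eventually_lt hrl hδ] with n hn
  exact (Q.sol n).lt_of_lt Q.two_lt Q.factor Q.tail (hr n) (hs n)
    ((div_lt_div_iff_of_pos_right (Q.family.top_pos n)).1 hn)

/-- Since `δ_{k+1} < δ_k` and `u` decreases, the pair of a later bubble eventually lies to the right
of the earlier pair, so each bubble adds two new zeros. The claim is for arbitrary pairs because the
induction starts from the pair given for bubble `k + 1` and picks its own pair for bubble `k`. -/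
theorem le_zeroCount (Q : BarrierProblem p c₀ τ₀ m h lam μ u R₀ U) (k : ℕ) :
    ∀ rm rp, CrossingPair μ u R₀ U (δSeq p k) rm rp →
      ∀ᶠ n in atTop, (2 * (k + 1) : ℕ∞) ≤
        zeroCount (Ioc 0 (rp n) ∩ Ioo 0 R₀) (fun r => u n r - U r) := by
  induction k with
  | zero =>
    intro rm rp hc
    filter_upwards [hc.zero] with n hn
    obtain ⟨h1, h2, h3⟩ := hc.mem n
    have hsub : ({rm n, rp n} : Set ℝ) ⊆ {r ∈ Ioc 0 (rp n) ∩ Ioo 0 R₀ | u n r - U r = 0} := by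
      rintro r (rfl | rfl)
      · exact ⟨⟨⟨h1.1, h3.le⟩, h1.1, hn.1⟩, sub_eq_zero.2 hn.2.2.1⟩
      · exact ⟨⟨⟨h2.1, le_rfl⟩, h2.1, hn.2.1⟩, sub_eq_zero.2 hn.2.2.2⟩
    refine le_trans ?_ (encard_le_encard hsub)
    rw [encard_pair h3.ne]
    norm_num
  | succ k ih =>
    intro rm rp hc
    obtain ⟨rc, hrc⟩ := Q.exists_isBubbleCenter k
    obtain ⟨rm', rp', hc', -⟩ := Q.exists_crossingPair hrc
    filter_upwards [hc.zero, ih rm' rp' hc', Q.eventually_lt_of_level_lt (fun n => (hc'.mem n).2.1)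
      (fun n => (hc.mem n).1) hc'.level_right hc.level_left (δSeq_aSeq_spec Q.two_lt k).1.2]
      with n hn hk hlt
    obtain ⟨h1, h2, h3⟩ := hc.mem n
    set Z := {r ∈ Ioc 0 (rp' n) ∩ Ioo 0 R₀ | u n r - U r = 0} with hZ
    have hsub : insert (rm n) (insert (rp n) Z) ⊆
        {r ∈ Ioc 0 (rp n) ∩ Ioo 0 R₀ | u n r - U r = 0} := by
      rintro r (rfl | rfl | hr)
      · exact ⟨⟨⟨h1.1, h3.le⟩, h1.1, hn.1⟩, sub_eq_zero.2 hn.2.2.1⟩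
      · exact ⟨⟨⟨h2.1, le_rfl⟩, h2.1, hn.2.1⟩, sub_eq_zero.2 hn.2.2.2⟩
      · exact ⟨⟨⟨hr.1.1.1, hr.1.1.2.trans (hlt.trans h3).le⟩, hr.1.2⟩, hr.2⟩
    have hp : rp n ∉ Z := fun hr => absurd hr.1.1.2 (not_le.2 (hlt.trans h3))
    have hm : rm n ∉ insert (rp n) Z := by
      rintro (hr | hr)
      · exact h3.ne hr
      · exact absurd hr.1.1.2 (not_le.2 hlt)
    refine le_trans ?_ (encard_le_encard hsub)
    rw [encard_insert_of_notMem hm, encard_insert_of_notMem hp]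
    have h4 : (2 * ((k + 1 : ℕ) + 1) : ℕ∞) = 2 * (k + 1) + 1 + 1 := by
      push_cast
      ring
    rw [h4]
    gcongr
    exact hk

theorem tendsto_zeroCount (Q : BarrierProblem p c₀ τ₀ m h lam μ u R₀ U) {s : ℕ → ℝ}
    (hs : ∀ n, s n ∈ Ioo (0 : ℝ) 1) (hlim : Tendsto (fun n => u n (s n) / μ n) atTop (𝓝 0)) :
    Tendsto (fun n => zeroCount (Ioo 0 (s n) ∩ Ioo 0 R₀) (fun r => u n r - U r)) atTop
      (𝓝 (⊤ : ℕ∞)) := by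
  rw [ENat.tendsto_nhds_top_iff_natCast_lt]
  intro k
  obtain ⟨rc, hrc⟩ := Q.exists_isBubbleCenter k
  obtain ⟨rm, rp, hc, -⟩ := Q.exists_crossingPair hrc
  filter_upwards [Q.le_zeroCount k rm rp hc, Q.eventually_lt_of_level_lt (fun n => (hc.mem n).2.1)
    hs hc.level_right hlim (δSeq_pos Q.two_lt k)] with n h1 h2
  refine lt_of_lt_of_le ?_ (h1.trans (encard_le_encard ?_))
  · exact_mod_cast (by omega : k < 2 * (k + 1))
  · rintro r ⟨⟨hr1, hr2⟩, hr3⟩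
    exact ⟨⟨⟨hr1.1, lt_of_le_of_lt hr1.2 h2⟩, hr2⟩, hr3⟩

end BarrierProblem

/-! ### The two alternatives for `U` and the conclusion. -/

/-- Only the sum `log Λ + L` matters at a center. It can be made small by the choice of `L` when
`log Λ` converges, and it tends to `-∞` for any fixed `L` when `lam → 0`; this unifies the two
cases. -/
theorem isBarrier_of_bounds {p c₀ m lamStar R₀ : ℝ} (hp : 2 < p) (hc : 0 < c₀) {lam : ℕ → ℝ}
    (hpos : ∀ n, 0 < lam n) (hlamStar : 0 ≤ lamStar) (hlam : Tendsto lam atTop (𝓝 lamStar))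
    (hR₀ : 0 < R₀) {U : ℝ → ℝ} (hUcont : ContinuousOn U (Ioo 0 R₀))
    (hU : (lamStar ≠ 0 ∧ ∀ ε ∈ Ioo (0 : ℝ) 2, ∀ L : ℝ, ∃ r₀ ∈ Ioo (0 : ℝ) 1, r₀ ≤ R₀ ∧
        ∀ r ∈ Ioo 0 r₀, Ucurve p (2 - ε) r ≤ U r ∧ U r ≤ Vcurve p m L r) ∨
      (lamStar = 0 ∧ ∀ ε ∈ Ioo (0 : ℝ) 2, ∃ r₀ ∈ Ioo (0 : ℝ) 1, ∃ L : ℝ, r₀ ≤ R₀ ∧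
        ∀ r ∈ Ioo 0 r₀, Ucurve p (2 - ε) r ≤ U r ∧ U r ≤ Vcurve p m L r)) :
    IsBarrier p m (fun n => p * lam n * c₀) R₀ U := by
  have hΛ : Tendsto (fun n => p * lam n * c₀) atTop (𝓝 (p * lamStar * c₀)) :=
    (hlam.const_mul p).mul_const c₀
  rcases hU with ⟨hne, hU⟩ | ⟨rfl, hU⟩
  · refine ⟨hR₀, hUcont, fun ε hε => ?_, fun A => ?_⟩
    · obtain ⟨r₀, hr₀, -, hr⟩ := hU ε hε 0
      exact ⟨r₀, hr₀.1, fun r h => (hr r h).1⟩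
    · have hs : 0 < lamStar := lt_of_le_of_ne hlamStar hne.symm
      obtain ⟨r₀, hr₀, -, hr⟩ := hU 1 (by norm_num) (A - Real.log (p * lamStar * c₀) - 1)
      refine ⟨_, r₀, hr₀.1, ?_, fun r h => (hr r h).2⟩
      have h1 := (hΛ.log (by positivity)).add_const (A - Real.log (p * lamStar * c₀) - 1)
      exact h1.eventually_lt_const (by linarith)
  · refine ⟨hR₀, hUcont, fun ε hε => ?_, fun A => ?_⟩
    · obtain ⟨r₀, hr₀, L, -, hr⟩ := hU ε hε
      exact ⟨r₀, hr₀.1, fun r h => (hr r h).1⟩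
    · obtain ⟨r₀, hr₀, L, -, hr⟩ := hU 1 (by norm_num)
      refine ⟨L, r₀, hr₀.1, ?_, fun r h => (hr r h).2⟩
      rw [mul_zero, zero_mul] at hΛ
      have h1 : Tendsto (fun n => Real.log (p * lam n * c₀)) atTop atBot := by
        refine Real.tendsto_log_nhdsGT_zero.comp (tendsto_nhdsWithin_iff.2 ⟨hΛ, ?_⟩)
        refine Eventually.of_forall fun n => ?_
        have := hpos n
        exact mem_Ioi.2 (by positivity)
      exact (tendsto_atBot_add_const_right _ L h1).eventually_lt_atBot A

end SupercriticalBubbles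

theorem corollary4p5
    (p c₀ τ₀ m : ℝ) (hp : 2 < p)
    (h : ℝ → ℝ) (hh : SupercriticalBubbles.AdmissibleFactor h)
    (hH3 : SupercriticalBubbles.PowerExpTail h p c₀ τ₀ m)
    (lam μ : ℕ → ℝ) (u : ℕ → ℝ → ℝ)
    (hsol : ∀ n, SupercriticalBubbles.IsRadialSolution
      (SupercriticalBubbles.nonlin h p) (lam n) (μ n) (u n))
    (hμ : Tendsto μ atTop atTop)
    (lamStar : ℝ) (hlamStar : 0 ≤ lamStar) (hlam : Tendsto lam atTop (𝓝 lamStar))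
    -- `U` is a continuous function on `(0, R₀)`
    (R₀ : ℝ) (hR₀ : 0 < R₀) (U : ℝ → ℝ) (hUcont : ContinuousOn U (Ioo 0 R₀))
    (hU :
      (lamStar ≠ 0 ∧ ∀ ε ∈ Ioo (0 : ℝ) 2, ∀ L : ℝ, ∃ r₀ ∈ Ioo (0 : ℝ) 1, r₀ ≤ R₀ ∧
        ∀ r ∈ Ioo 0 r₀, SupercriticalBubbles.Ucurve p (2 - ε) r ≤ U r ∧
          U r ≤ SupercriticalBubbles.Vcurve p m L r) ∨
      (lamStar = 0 ∧ ∀ ε ∈ Ioo (0 : ℝ) 2, ∃ r₀ ∈ Ioo (0 : ℝ) 1, ∃ L : ℝ, r₀ ≤ R₀ ∧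
        ∀ r ∈ Ioo 0 r₀, SupercriticalBubbles.Ucurve p (2 - ε) r ≤ U r ∧
          U r ≤ SupercriticalBubbles.Vcurve p m L r)) :
    -- up to a subsequence `σ`
    ∃ σ : ℕ → ℕ, StrictMono σ ∧
      -- centers of the `(k+1)`-th bubble exist for every `k`
      (∀ k : ℕ, ∃ rc : ℕ → ℝ, SupercriticalBubbles.IsBubbleCenter
        (SupercriticalBubbles.nonlin h p) p (lam ∘ σ) (μ ∘ σ) (u ∘ σ) k rc) ∧
      -- intersections on both sides of any such centers
      (∀ (k : ℕ) (rc : ℕ → ℝ), SupercriticalBubbles.IsBubbleCenter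
          (SupercriticalBubbles.nonlin h p) p (lam ∘ σ) (μ ∘ σ) (u ∘ σ) k rc →
        ∃ rm rp : ℕ → ℝ,
          (∀ n, rm n ∈ Ioo (0 : ℝ) 1 ∧ rp n ∈ Ioo (0 : ℝ) 1 ∧ rm n < rc n ∧ rc n < rp n) ∧
          Tendsto (fun n => u (σ n) (rm n) / μ (σ n)) atTop
            (𝓝 (SupercriticalBubbles.δSeq p k)) ∧
          Tendsto (fun n => u (σ n) (rp n) / μ (σ n)) atTop
            (𝓝 (SupercriticalBubbles.δSeq p k)) ∧
          (∀ᶠ n in atTop, rm n < R₀ ∧ rp n < R₀ ∧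
            u (σ n) (rm n) = U (rm n) ∧ u (σ n) (rp n) = U (rp n)) ∧
          (∀ᶠ n in atTop, (2 * (k + 1) : ℕ∞) ≤
            SupercriticalBubbles.zeroCount (Ioc 0 (rp n) ∩ Ioo 0 R₀)
              (fun r => u (σ n) r - U r))) ∧
      -- divergence of the intersection number
      (∀ s : ℕ → ℝ, (∀ n, s n ∈ Ioo (0 : ℝ) 1) →
        Tendsto (fun n => u (σ n) (s n) / μ (σ n)) atTop (𝓝 0) →
        Tendsto (fun n => SupercriticalBubbles.zeroCount (Ioo 0 (s n) ∩ Ioo 0 R₀)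
          (fun r => u (σ n) r - U r)) atTop (𝓝 (⊤ : ℕ∞))) := by
  have Q : SupercriticalBubbles.BarrierProblem p c₀ τ₀ m h lam μ u R₀ U :=
    ⟨hp, hh, hH3, hsol, hμ, ⟨p * (lamStar + 1) * c₀, by
      filter_upwards [hlam.eventually_lt_const (lt_add_one lamStar)] with n hn
      have := hH3.c₀_pos
      gcongr⟩, SupercriticalBubbles.isBarrier_of_bounds hp hH3.c₀_pos (fun n => (hsol n).lam_pos)
        hlamStar hlam hR₀ hUcont hU⟩
  -- All limits are obtained along the full sequence, so no subsequence is needed.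
  refine ⟨id, strictMono_id, Q.exists_isBubbleCenter, fun k rc hrc => ?_,
    fun s hs hlim => Q.tendsto_zeroCount hs hlim⟩
  obtain ⟨rm, rp, hc, hlt⟩ := Q.exists_crossingPair hrc
  exact ⟨rm, rp, fun n => ⟨(hc.mem n).1, (hc.mem n).2.1, (hlt n).1, (hlt n).2⟩, hc.level_left,
    hc.level_right, hc.zero, Q.le_zeroCount k rm rp hc⟩
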